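/- Let $K$ be a number field with ring of integers $O_K$ and fix an embedding $\sigma: K\to\mathbb{C}$. A hermitian $O_K$-module is a finitely generated projective $O_K$-module $E$ with a hermitian inner product on $E_\tau=E\otimes_{O_K,\tau}\mathbb{C}$ for every embedding $\tau:K\to\mathbb{C}$, compatible with complex conjugation; write $E_K=E\otimes_{O_K}K$ and $E_{\mathbb{C}}=E_\sigma$. Let $E$ be a hermitian $O_K$-module and let $H$ be a hermitian line bundle over $\mathrm{Spec}(O_K)$ (a hermitian $O_K$-module that is invertible). Let $E_n=\mathrm{Sym}^n(E)$ with the quotient metric of $E^{\otimes n}$, let $m_n$ be its rank, and put $E_n^\vee(x)=E_n^\vee\otimes H^{\otimes x}=\mathrm{Hom}(E_n,H^{\otimes x})$ with its hermitian norms $\|\cdot\|_\tau$. Let $f\in E_{\mathbb{C}}$ with $f\neq 0$, and let $f_n\in (E_n)_{\mathbb{C}}$ be the image of $f^{\otimes n}$. Suppose that there are real constants $c_1,c_2,c_3$ with $c_2>0$, independent of $n$, such that for every sufficiently large $n$ there are real constants $b_1,b_2$ (which may depend on $n$) for which the following holds: for every sufficiently large integer $x$ there are $P_1,\dots,P_{m_n}\in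 E_n^\vee(x)$ such that - $P_1,\dots,P_{m_n}$ are linearly independent; - $\log\|P_i\|_\tau\le c_1x\log x+b_1x$ for all $i$ and all embeddings $\tau:K\to\mathbb{C}$; - $\log\|\langle P_i,f_n\rangle\|_\sigma\le c_1x\log x-c_2m_nx\log x+c_3x\log x+b_2x$ for all $i$ (with $\log 0=-\infty$). Then $f$ is algebraically independent over $K$ in the following sense: for every $n\ge1$, the smallest $K$-subspace $V_n$ of $(E_n)_K$ such that $f_n\in V_n\otimes_{K,\sigma}\mathbb{C}$ is $(E_n)_K$ itself. In terms of coordinates: in any $K$-basis of $E_K$, the coordinates of $f$ satisfy no nontrivial homogeneous polynomial relation with coefficients in $\sigma(K)$. -/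

import Mathlib

open NumberField Module Filter
open scoped TensorProduct ComplexConjugate

namespace Hermitian

section Complexification

variable {K : Type} [Field K] (σ : K →+* ℂ)

/-- The ring homomorphism `𝓞 K → ℂ` given by the complex embedding `σ` of `K`. -/
abbrev emb : 𝓞 K →+* ℂ := σ.comp (algebraMap (𝓞 K) K)

/-- The complex vector space `E_σ = ℂ ⊗ E`, where `ℂ` is an `𝓞 K`-algebra through `σ`. -/
def Cx (E : Type*) [AddCommGroup E] [Module (𝓞 K) E] : Type _ :=
  letI : Algebra (𝓞 K) ℂ := (emb σ).toAlgebra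
  ℂ ⊗[𝓞 K] E

variable {E : Type*} [AddCommGroup E] [Module (𝓞 K) E]
variable {F : Type*} [AddCommGroup F] [Module (𝓞 K) F]

noncomputable instance : AddCommGroup (Cx σ E) :=
  letI : Algebra (𝓞 K) ℂ := (emb σ).toAlgebra
  (inferInstance : AddCommGroup (ℂ ⊗[𝓞 K] E))

noncomputable instance : Module ℂ (Cx σ E) :=
  letI : Algebra (𝓞 K) ℂ := (emb σ).toAlgebra
  (inferInstance : Module ℂ (ℂ ⊗[𝓞 K] E))

instance [Module.Finite (𝓞 K) E] : FiniteDimensional ℂ (Cx σ E) :=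
  letI : Algebra (𝓞 K) ℂ := (emb σ).toAlgebra
  (inferInstance : Module.Finite ℂ (ℂ ⊗[𝓞 K] E))

/-- The canonical map `E → E_σ`, `e ↦ 1 ⊗ e`. -/
noncomputable def toCx : E →ₛₗ[emb σ] Cx σ E :=
  letI : Algebra (𝓞 K) ℂ := (emb σ).toAlgebra
  { toFun := fun e => ((1 : ℂ) ⊗ₜ[𝓞 K] e : ℂ ⊗[𝓞 K] E)
    map_add' := fun a b => TensorProduct.tmul_add _ _ _
    map_smul' := fun r a => by
      change (1 : ℂ) ⊗ₜ[𝓞 K] (r • a) = (emb σ r) • ((1 : ℂ) ⊗ₜ[𝓞 K] a)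
      rw [← TensorProduct.smul_tmul, TensorProduct.smul_tmul', Algebra.smul_def]
      rfl }

/-- The universal property of `E_σ`. -/
noncomputable def liftCx {W : Type*} [AddCommGroup W] [Module ℂ W] (g : E →ₛₗ[emb σ] W) :
    Cx σ E →ₗ[ℂ] W :=
  letI : Algebra (𝓞 K) ℂ := (emb σ).toAlgebra
  letI : Module (𝓞 K) W := Module.compHom W (emb σ)
  haveI : IsScalarTower (𝓞 K) ℂ W := ⟨fun r z w => by
    rw [Algebra.smul_def, mul_smul]; rfl⟩
  LinearMap.liftBaseChange (M := E) ℂ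
    { toFun := g, map_add' := g.map_add, map_smul' := fun r a => g.map_smulₛₗ r a }

theorem liftCx_toCx {W : Type*} [AddCommGroup W] [Module ℂ W] (g : E →ₛₗ[emb σ] W) (e : E) :
    liftCx σ g (toCx σ e) = g e :=
  one_smul ℂ (g e)

theorem Cx.induction {p : Cx σ E → Prop} (h0 : p 0) (hs : ∀ (z : ℂ) (e : E), p (z • toCx σ e))
    (ha : ∀ u v, p u → p v → p (u + v)) (u : Cx σ E) : p u := by
  let : Algebra (𝓞 K) ℂ := (emb σ).toAlgebra
  refine TensorProduct.induction_on (R := 𝓞 K) (M := ℂ) (N := E) (motive := p) u h0 ?_ ha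
  intro z e
  have h := hs z e
  have h2 : z • toCx σ e = (z ⊗ₜ[𝓞 K] e : ℂ ⊗[𝓞 K] E) := by
    change z • ((1 : ℂ) ⊗ₜ[𝓞 K] e : ℂ ⊗[𝓞 K] E) = _
    rw [TensorProduct.smul_tmul']
    simp
  rwa [h2] at h

theorem Cx.ext {W : Type*} [AddCommGroup W] [Module ℂ W] {g h : Cx σ E →ₗ[ℂ] W}
    (H : ∀ e, g (toCx σ e) = h (toCx σ e)) : g = h := by
  ext u
  induction u using Cx.induction with
  | h0 => simp
  | hs z e => simp [H]
  | ha u v hu hv => simp [hu, hv]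

/-- The complexification `φ_σ : E_σ → F_σ` of an `𝓞 K`-linear map `φ`. -/
noncomputable def mapCx (φ : E →ₗ[𝓞 K] F) : Cx σ E →ₗ[ℂ] Cx σ F :=
  liftCx σ ((toCx σ).comp φ)

theorem mapCx_toCx (φ : E →ₗ[𝓞 K] F) (e : E) : mapCx σ φ (toCx σ e) = toCx σ (φ e) :=
  liftCx_toCx σ _ e

variable (E) in
/-- The canonical map `E_K = K ⊗ E → E_σ`, `k ⊗ e ↦ σ k • (1 ⊗ e)`. -/
noncomputable def genericToCx : K ⊗[𝓞 K] E →ₛₗ[σ] Cx σ E :=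
  letI : Algebra (𝓞 K) ℂ := (emb σ).toAlgebra
  let s : K →ₗ[𝓞 K] ℂ :=
    { toFun := σ, map_add' := map_add σ,
      map_smul' := fun r k => by rw [Algebra.smul_def, map_mul, Algebra.smul_def]; rfl }
  { toFun := fun u => (TensorProduct.map s LinearMap.id u : ℂ ⊗[𝓞 K] E)
    map_add' := fun u v => map_add (TensorProduct.map s LinearMap.id) u v
    map_smul' := fun k u => by
      change TensorProduct.map s LinearMap.id (k • u) =
        σ k • TensorProduct.map s (LinearMap.id : E →ₗ[𝓞 K] E) u
      induction u using TensorProduct.induction_on with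
      | zero => simp
      | tmul a e =>
        rw [TensorProduct.smul_tmul', TensorProduct.map_tmul, TensorProduct.map_tmul,
          TensorProduct.smul_tmul']
        congr 1
        exact map_mul σ k a
      | add u v hu hv => rw [smul_add, map_add, map_add, hu, hv, smul_add] }

theorem genericToCx_tmul (k : K) (e : E) :
    genericToCx σ E (k ⊗ₜ[𝓞 K] e) = σ k • toCx σ e := by
  let : Algebra (𝓞 K) ℂ := (emb σ).toAlgebra
  change (σ k ⊗ₜ[𝓞 K] e : ℂ ⊗[𝓞 K] E) = σ k • ((1 : ℂ) ⊗ₜ[𝓞 K] e : ℂ ⊗[𝓞 K] E)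
  rw [TensorProduct.smul_tmul']
  simp

/-- The complexification `(E_σ)ⁿ → F_σ` of an `𝓞 K`-multilinear map `Eⁿ → F`, by recursion on the
number of variables. -/
noncomputable def multiCx : (n : ℕ) → MultilinearMap (𝓞 K) (fun _ : Fin n => E) F →ₛₗ[emb σ]
    MultilinearMap ℂ (fun _ : Fin n => Cx σ E) (Cx σ F)
  | 0 =>
    { toFun := fun g => MultilinearMap.constOfIsEmpty ℂ _ (toCx σ (g 0))
      map_add' := fun g h => by ext; simp
      map_smul' := fun r g => by ext; simp }
  | n + 1 =>
    { toFun := fun g => (liftCx σ ((multiCx n).comp g.curryLeft)).uncurryLeft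
      map_add' := fun g h => by
        have : liftCx σ ((multiCx n).comp (g + h).curryLeft) =
            liftCx σ ((multiCx n).comp g.curryLeft) + liftCx σ ((multiCx n).comp h.curryLeft) := by
          refine Cx.ext σ fun e => ?_
          rw [LinearMap.add_apply, liftCx_toCx, liftCx_toCx, liftCx_toCx]
          exact map_add (multiCx n) (g.curryLeft e) (h.curryLeft e)
        rw [this]; rfl
      map_smul' := fun r g => by
        have : liftCx σ ((multiCx n).comp (r • g).curryLeft) =
            emb σ r • liftCx σ ((multiCx n).comp g.curryLeft) := by
          refine Cx.ext σ fun e => ?_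
          rw [LinearMap.smul_apply, liftCx_toCx, liftCx_toCx]
          exact LinearMap.map_smulₛₗ (multiCx n) r (g.curryLeft e)
        rw [this]; rfl }

theorem multiCx_toCx : ∀ (n : ℕ) (g : MultilinearMap (𝓞 K) (fun _ : Fin n => E) F) (u : Fin n → E),
    multiCx σ n g (fun i => toCx σ (u i)) = toCx σ (g u)
  | 0, g, u => by
    change toCx σ (g 0) = _
    rw [Subsingleton.elim u 0]
  | n + 1, g, u => by
    change liftCx σ ((multiCx σ n).comp g.curryLeft) (toCx σ (u 0))
      (fun i : Fin n => toCx σ (u i.succ)) = _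
    rw [liftCx_toCx]
    change multiCx σ n (g.curryLeft (u 0)) (fun i : Fin n => toCx σ (u i.succ)) = _
    rw [multiCx_toCx n]
    congr 1
    change g (Fin.cons (u 0) (fun i => u i.succ)) = g u
    congr 1
    exact Fin.cons_self_tail u

end Complexification

/-- A hermitian metric on an `𝓞 K`-module `E`: for each embedding `σ : K → ℂ` a hermitian inner
product on `E_σ` (conjugate-linear in the first variable), compatible with complex conjugation. -/
structure Metric (K : Type) [Field K] (E : Type*) [AddCommGroup E]
    [Module (𝓞 K) E] where
  inner : ∀ σ : K →+* ℂ, Cx σ E →ₗ⋆[ℂ] Cx σ E →ₗ[ℂ] ℂ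
  conj_symm : ∀ σ u v, conj (inner σ v u) = inner σ u v
  pos : ∀ σ u, u ≠ 0 → 0 < (inner σ u u).re
  conj_invariant : ∀ σ (u v : E),
    inner (ComplexEmbedding.conjugate σ) (toCx _ u) (toCx _ v) =
      conj (inner σ (toCx σ u) (toCx σ v))

variable {K : Type} [Field K]
variable {E : Type*} [AddCommGroup E] [Module (𝓞 K) E]

namespace Metric

/-- The norm `‖u‖_σ` of `u ∈ E_σ`. -/
noncomputable def norm (h : Metric K E) (σ : K →+* ℂ) (u : Cx σ E) : ℝ :=
  √(h.inner σ u u).re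

/-- The inner product on `E_σ` in Mathlib's packaging. -/
@[reducible] noncomputable def core (h : Metric K E) (σ : K →+* ℂ) : InnerProductSpace.Core ℂ (Cx σ E) where
  inner u v := h.inner σ u v
  conj_inner_symm u v := h.conj_symm σ u v
  re_inner_nonneg u := by
    by_cases hu : u = 0
    · simp [hu]
    · exact (h.pos σ u hu).le
  add_left u v w := by simp
  smul_left u v r := by simp
  definite u hu := by
    by_contra hne
    have := h.pos σ u hne
    rw [hu] at this
    simp at this

theorem exists_orthonormal [Module.Finite (𝓞 K) E] (h : Metric K E) (σ : K →+* ℂ) :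
    ∃ e : Fin (finrank ℂ (Cx σ E)) → Cx σ E,
      (∀ i j, h.inner σ (e i) (e j) = if i = j then 1 else 0) ∧
      (∀ u, u = ∑ i, h.inner σ (e i) u • e i) ∧
      (∀ u v, h.inner σ u v = ∑ i, conj (h.inner σ (e i) u) * h.inner σ (e i) v) := by
  let := h.core σ
  let : NormedAddCommGroup (Cx σ E) := (h.core σ).toNormedAddCommGroup
  let : InnerProductSpace ℂ (Cx σ E) := InnerProductSpace.ofCore (h.core σ).toCore
  let b := stdOrthonormalBasis ℂ (Cx σ E)
  have h2 : ∀ u, u = ∑ i, h.inner σ (b i) u • b i := fun u => (b.sum_repr' u).symm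
  refine ⟨b, fun i j => b.inner_eq_ite i j, h2, fun u v => ?_⟩
  conv_lhs => rw [h2 v]
  simp only [map_sum, map_smul, smul_eq_mul]
  refine Finset.sum_congr rfl fun i _ => ?_
  rw [h.conj_symm, mul_comm]

end Metric

section Forms

variable {V W : Type*} [AddCommGroup V] [Module ℂ V] [AddCommGroup W] [Module ℂ W]

/-- The sesquilinear form `(u, v) ↦ B (s u) (s v)`. -/
noncomputable def pullForm (B : W →ₗ⋆[ℂ] W →ₗ[ℂ] ℂ) (s : V →ₗ[ℂ] W) : V →ₗ⋆[ℂ] V →ₗ[ℂ] ℂ :=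
  LinearMap.mk₂'ₛₗ (starRingEnd ℂ) (RingHom.id ℂ) (fun u v => B (s u) (s v))
    (by simp) (by simp) (by simp) (by simp)

/-- The sesquilinear form `(u, v) ↦ ∑ i, conj (Φ i u) * Φ i v`. -/
noncomputable def coordForm {I : Type*} [Fintype I] (Φ : I → V →ₗ[ℂ] ℂ) :
    V →ₗ⋆[ℂ] V →ₗ[ℂ] ℂ :=
  LinearMap.mk₂'ₛₗ (starRingEnd ℂ) (RingHom.id ℂ) (fun u v => ∑ i, conj (Φ i u) * Φ i v)
    (by intros; simp [add_mul, Finset.sum_add_distrib])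
    (by intros; simp [Finset.mul_sum, mul_assoc])
    (by intros; simp [mul_add, Finset.sum_add_distrib])
    (by intros; simp [Finset.mul_sum, mul_left_comm])

theorem conj_invariant_of_span {σ : K →+* ℂ} (S : Set E) (hS : Submodule.span (𝓞 K) S = ⊤)
    (B : Cx σ E →ₗ⋆[ℂ] Cx σ E →ₗ[ℂ] ℂ)
    (B' : Cx (ComplexEmbedding.conjugate σ) E →ₗ⋆[ℂ]
      Cx (ComplexEmbedding.conjugate σ) E →ₗ[ℂ] ℂ)
    (h : ∀ u ∈ S, ∀ v ∈ S, B' (toCx _ u) (toCx _ v) = conj (B (toCx σ u) (toCx σ v))) (u v : E) :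
    B' (toCx _ u) (toCx _ v) = conj (B (toCx σ u) (toCx σ v)) := by
  have hu : u ∈ Submodule.span (𝓞 K) S := by simp [hS]
  have hv : v ∈ Submodule.span (𝓞 K) S := by simp [hS]
  induction hu using Submodule.span_induction with
  | mem u hu =>
    induction hv using Submodule.span_induction with
    | mem v hv => exact h u hu v hv
    | zero => simp
    | add a b _ _ ha hb => simp [ha, hb]
    | smul r a _ ha => simp [ha]
  | zero => simp
  | add a b _ _ ha hb => simp [ha, hb]
  | smul r a _ ha => simp [ha]

end Forms

section TensorPower

/-- The linear form on `(E^{⊗ n})_σ` that sends `u₁ ⊗ ⋯ ⊗ uₙ` to `∏ φᵢ uᵢ`. -/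
noncomputable def tensorForm (σ : K →+* ℂ) {n : ℕ} (φ : Fin n → (Cx σ E →ₗ[ℂ] ℂ)) :
    Cx σ (⨂[𝓞 K]^n E) →ₗ[ℂ] ℂ :=
  letI : Algebra (𝓞 K) ℂ := (emb σ).toAlgebra
  let l : MultilinearMap (𝓞 K) (fun _ : Fin n => E) ℂ :=
    (MultilinearMap.mkPiAlgebra (𝓞 K) (Fin n) ℂ).compLinearMap fun i =>
      { toFun := fun u => φ i (toCx σ u)
        map_add' := fun u v => by simp
        map_smul' := fun r u => by simp [Algebra.smul_def]; left; rfl }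
  liftCx σ
    { toFun := PiTensorProduct.lift l
      map_add' := map_add _
      map_smul' := fun r u => by rw [map_smul, Algebra.smul_def]; rfl }

theorem tensorForm_tprod (σ : K →+* ℂ) {n : ℕ} (φ : Fin n → (Cx σ E →ₗ[ℂ] ℂ)) (u : Fin n → E) :
    tensorForm σ φ (toCx σ (PiTensorProduct.tprod (𝓞 K) u)) = ∏ i, φ i (toCx σ (u i)) := by
  unfold tensorForm
  rw [liftCx_toCx]
  let : Algebra (𝓞 K) ℂ := (emb σ).toAlgebra
  exact PiTensorProduct.lift.tprod _

variable [Module.Finite (𝓞 K) E]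

/-- The coordinates of a tensor in the basis of `(E^{⊗ n})_σ` given by the tensor products of the
members of an orthonormal basis of `E_σ`. -/
noncomputable def Metric.tensorCoord (h : Metric K E) (σ : K →+* ℂ) (n : ℕ)
    (I : Fin n → Fin (finrank ℂ (Cx σ E))) : Cx σ (⨂[𝓞 K]^n E) →ₗ[ℂ] ℂ :=
  tensorForm σ fun j => h.inner σ ((h.exists_orthonormal σ).choose (I j))

theorem Metric.tensorCoord_expand (h : Metric K E) (σ : K →+* ℂ) (n : ℕ)
    (t : Cx σ (⨂[𝓞 K]^n E)) :
    t = ∑ I, h.tensorCoord σ n I t • multiCx σ n (PiTensorProduct.tprod (𝓞 K))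
      (fun j => (h.exists_orthonormal σ).choose (I j)) := by
  set e := (h.exists_orthonormal σ).choose with he
  have hexp := (h.exists_orthonormal σ).choose_spec.2.1
  rw [← he] at hexp
  induction t using Cx.induction with
  | h0 => simp
  | ha u v hu hv =>
    conv_lhs => rw [hu, hv]
    simp [add_smul, Finset.sum_add_distrib]
  | hs z t =>
    have key : toCx σ t = ∑ I, h.tensorCoord σ n I (toCx σ t) •
        multiCx σ n (PiTensorProduct.tprod (𝓞 K)) (fun j => e (I j)) := by
      induction t using PiTensorProduct.induction_on with
      | smul_tprod r u =>
        have h1 : toCx σ (PiTensorProduct.tprod (𝓞 K) u) =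
            ∑ I, h.tensorCoord σ n I (toCx σ (PiTensorProduct.tprod (𝓞 K) u)) •
              multiCx σ n (PiTensorProduct.tprod (𝓞 K)) (fun j => e (I j)) := by
          conv_lhs => rw [← multiCx_toCx σ n (PiTensorProduct.tprod (𝓞 K)) u]
          have h2 : (fun i => toCx σ (u i)) =
              fun i => ∑ k, h.inner σ (e k) (toCx σ (u i)) • e k := by
            funext i
            exact hexp _
          rw [h2, MultilinearMap.map_sum]
          refine Finset.sum_congr rfl fun I _ => ?_
          rw [MultilinearMap.map_smul_univ]
          congr 1
          exact (tensorForm_tprod σ _ u).symm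
        rw [LinearMap.map_smulₛₗ]
        conv_lhs => rw [h1]
        simp [Finset.smul_sum, mul_smul]
      | add a b ha hb =>
        rw [map_add]
        conv_lhs => rw [ha, hb]
        simp [add_smul, Finset.sum_add_distrib]
    conv_lhs => rw [key]
    simp [Finset.smul_sum, mul_smul]

theorem Metric.coordForm_tprod (h : Metric K E) (σ : K →+* ℂ) (n : ℕ) (u v : Fin n → E) :
    coordForm (h.tensorCoord σ n) (toCx σ (PiTensorProduct.tprod (𝓞 K) u))
      (toCx σ (PiTensorProduct.tprod (𝓞 K) v)) =
      ∏ i, h.inner σ (toCx σ (u i)) (toCx σ (v i)) := by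
  have hin := (h.exists_orthonormal σ).choose_spec.2.2
  simp_rw [fun i => hin (toCx σ (u i)) (toCx σ (v i))]
  rw [Finset.prod_univ_sum, Fintype.piFinset_univ]
  refine Finset.sum_congr rfl fun I _ => ?_
  unfold Metric.tensorCoord
  rw [tensorForm_tprod, tensorForm_tprod, map_prod, Finset.prod_mul_distrib]

/-- The metric on the tensor power `E^{⊗ n}`; see `Metric.tensorPower_tprod`. -/
noncomputable def Metric.tensorPower (h : Metric K E) (n : ℕ) : Metric K (⨂[𝓞 K]^n E) where
  inner σ := coordForm (h.tensorCoord σ n)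
  conj_symm σ u v := by simp [coordForm, mul_comm]
  pos σ u hu := by
    have h1 : (coordForm (h.tensorCoord σ n) u u).re =
        ∑ I, ‖h.tensorCoord σ n I u‖ ^ 2 := by
      simp only [coordForm, LinearMap.mk₂'ₛₗ_apply, Complex.re_sum]
      refine Finset.sum_congr rfl fun I _ => ?_
      rw [← Complex.normSq_eq_conj_mul_self, Complex.ofReal_re, Complex.normSq_eq_norm_sq]
    rw [h1]
    refine lt_of_le_of_ne (Finset.sum_nonneg fun I _ => sq_nonneg _) fun h0 => hu ?_
    rw [eq_comm, Finset.sum_eq_zero_iff_of_nonneg fun I _ => sq_nonneg _] at h0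
    rw [h.tensorCoord_expand σ n u]
    refine Finset.sum_eq_zero fun I hI => ?_
    have := h0 I hI
    rw [sq_eq_zero_iff, norm_eq_zero] at this
    rw [this, zero_smul]
  conj_invariant σ := conj_invariant_of_span _ (PiTensorProduct.span_tprod_eq_top) _ _ (by
    rintro _ ⟨u, rfl⟩ _ ⟨v, rfl⟩
    rw [h.coordForm_tprod, h.coordForm_tprod, map_prod]
    exact Finset.prod_congr rfl fun i _ => h.conj_invariant σ _ _)

/-- `⟪u₁ ⊗ ⋯ ⊗ uₙ, v₁ ⊗ ⋯ ⊗ vₙ⟫ = ∏ ⟪uᵢ, vᵢ⟫`. -/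
theorem Metric.tensorPower_tprod (h : Metric K E) (σ : K →+* ℂ) (n : ℕ) (u v : Fin n → E) :
    (h.tensorPower n).inner σ (toCx σ (PiTensorProduct.tprod (𝓞 K) u))
      (toCx σ (PiTensorProduct.tprod (𝓞 K) v)) =
      ∏ i, h.inner σ (toCx σ (u i)) (toCx σ (v i)) :=
  h.coordForm_tprod σ n u v

end TensorPower

section SymmetricPower

open Equiv

variable (K E) in
/-- The map `Symⁿ E → E^{⊗ n}`, `u₁ ⋯ uₙ ↦ ∑ π, u_{π 1} ⊗ ⋯ ⊗ u_{π n}`. -/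
noncomputable def symmetrize (n : ℕ) : Sym[𝓞 K]^n E →ₗ[𝓞 K] ⨂[𝓞 K]^n E :=
  let g : ⨂[𝓞 K]^n E →ₗ[𝓞 K] ⨂[𝓞 K]^n E :=
    ∑ π : Perm (Fin n), (PiTensorProduct.reindex (𝓞 K) (fun _ => E) π).toLinearMap
  let g' : Sym[𝓞 K]^n E →+ ⨂[𝓞 K]^n E :=
    AddCon.lift _ g.toAddMonoidHom (AddCon.addConGen_le.mpr (by
      rintro _ _ ⟨e, u⟩
      change g _ = g _
      simp only [g, LinearMap.sum_apply, LinearEquiv.coe_coe, PiTensorProduct.reindex_tprod]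
      refine Fintype.sum_equiv (Equiv.mulRight e) _ _ fun π => ?_
      congr 1
      funext i
      simp [Perm.mul_def]))
  { g' with
    map_smul' := fun r s => by
      induction s using AddCon.induction_on with
      | _ t => exact map_smul g r t }

theorem symmetrize_tprod (n : ℕ) (u : Fin n → E) :
    symmetrize K E n (SymmetricPower.tprod (𝓞 K) u) =
      ∑ π : Perm (Fin n), PiTensorProduct.tprod (𝓞 K) (fun i => u (π i)) := by
  change (∑ π : Perm (Fin n), (PiTensorProduct.reindex (𝓞 K) (fun _ => E) π).toLinearMap)
    (PiTensorProduct.tprod (𝓞 K) u) = _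
  simp only [LinearMap.sum_apply, LinearEquiv.coe_coe, PiTensorProduct.reindex_tprod]
  exact Fintype.sum_equiv (Equiv.inv (Perm (Fin n))) _ _ fun π => rfl

theorem mk_symmetrize (n : ℕ) (s : Sym[𝓞 K]^n E) :
    SymmetricPower.mk (𝓞 K) (Fin n) E (symmetrize K E n s) = (n.factorial : 𝓞 K) • s := by
  have hs : s ∈ Submodule.span (𝓞 K)
      (Set.range (SymmetricPower.tprod (𝓞 K) (ι := Fin n) (M := E))) := by
    simp [SymmetricPower.span_tprod_eq_top]
  induction hs using Submodule.span_induction with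
  | mem s hs =>
    obtain ⟨u, rfl⟩ := hs
    rw [symmetrize_tprod, map_sum]
    have : ∀ π : Perm (Fin n), SymmetricPower.mk (𝓞 K) (Fin n) E
        (PiTensorProduct.tprod (𝓞 K) fun i => u (π i)) = SymmetricPower.tprod (𝓞 K) u :=
      fun π => SymmetricPower.tprod_equiv π u
    simp_rw [this]
    rw [Finset.sum_const, Finset.card_univ, Fintype.card_perm, Fintype.card_fin, Nat.cast_smul_eq_nsmul]
  | zero => simp
  | add a b _ _ ha hb => rw [map_add, map_add, ha, hb, smul_add]
  | smul r a _ ha => rw [map_smul, map_smul, ha, smul_comm]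

/-- The section `u₁ ⋯ uₙ ↦ (1 / n!) ∑ π, u_{π 1} ⊗ ⋯ ⊗ u_{π n}` of the quotient map
`(E^{⊗ n})_σ → (Symⁿ E)_σ`; its values are the lifts orthogonal to the kernel. -/
noncomputable def symmetrizeCx (σ : K →+* ℂ) (n : ℕ) :
    Cx σ (Sym[𝓞 K]^n E) →ₗ[ℂ] Cx σ (⨂[𝓞 K]^n E) :=
  (n.factorial : ℂ)⁻¹ • mapCx σ (symmetrize K E n)

theorem mapCx_mk_symmetrizeCx (σ : K →+* ℂ) (n : ℕ) (s : Cx σ (Sym[𝓞 K]^n E)) :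
    mapCx σ (SymmetricPower.mk (𝓞 K) (Fin n) E) (symmetrizeCx σ n s) = s := by
  have : (mapCx σ (SymmetricPower.mk (𝓞 K) (Fin n) E)) ∘ₗ (symmetrizeCx σ n) =
      (LinearMap.id : Cx σ (Sym[𝓞 K]^n E) →ₗ[ℂ] _) := by
    refine Cx.ext σ fun s => ?_
    simp only [symmetrizeCx, LinearMap.comp_apply, LinearMap.smul_apply, map_smul, mapCx_toCx,
      LinearMap.id_apply]
    rw [mk_symmetrize, LinearMap.map_smulₛₗ, map_natCast, smul_smul, inv_mul_cancel₀, one_smul]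
    exact_mod_cast n.factorial_ne_zero
  exact LinearMap.congr_fun this s

theorem symmetrizeCx_tprod (σ : K →+* ℂ) (n : ℕ) (u : Fin n → E) :
    symmetrizeCx σ n (toCx σ (SymmetricPower.tprod (𝓞 K) u)) = (n.factorial : ℂ)⁻¹ •
      ∑ π : Perm (Fin n), toCx σ (PiTensorProduct.tprod (𝓞 K) (fun i => u (π i))) := by
  rw [symmetrizeCx, LinearMap.smul_apply, mapCx_toCx, symmetrize_tprod, map_sum]

variable [Module.Finite (𝓞 K) E]

/-- The quotient metric on `Symⁿ E`, as a quotient of `E^{⊗ n}`: the metric that makes the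
orthogonal lift `(Symⁿ E)_σ → (E^{⊗ n})_σ` isometric. -/
noncomputable def Metric.symPower (h : Metric K E) (n : ℕ) : Metric K (Sym[𝓞 K]^n E) where
  inner σ := pullForm ((h.tensorPower n).inner σ) (symmetrizeCx σ n)
  conj_symm σ u v := (h.tensorPower n).conj_symm σ _ _
  pos σ u hu := (h.tensorPower n).pos σ _ fun h0 => hu (by
    rw [← mapCx_mk_symmetrizeCx σ n u, h0, map_zero])
  conj_invariant σ := conj_invariant_of_span _ (SymmetricPower.span_tprod_eq_top (𝓞 K) (Fin n) E)
    _ _ (by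
    rintro _ ⟨u, rfl⟩ _ ⟨v, rfl⟩
    simp only [pullForm, LinearMap.mk₂'ₛₗ_apply, symmetrizeCx_tprod]
    simp [(h.tensorPower n).conj_invariant σ])

/-- `⟪u₁ ⋯ uₙ, v₁ ⋯ vₙ⟫ = (1 / n!) ∑ π, ∏ i, ⟪u_{π i}, vᵢ⟫`. -/
theorem Metric.symPower_tprod (h : Metric K E) (σ : K →+* ℂ) (n : ℕ) (u v : Fin n → E) :
    (h.symPower n).inner σ (toCx σ (SymmetricPower.tprod (𝓞 K) u))
      (toCx σ (SymmetricPower.tprod (𝓞 K) v)) =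
      (n.factorial : ℂ)⁻¹ *
        ∑ π : Perm (Fin n), ∏ i, h.inner σ (toCx σ (u (π i))) (toCx σ (v i)) := by
  change pullForm _ _ _ _ = _
  simp only [pullForm, LinearMap.mk₂'ₛₗ_apply, symmetrizeCx_tprod, map_sum, map_smul,
    LinearMap.map_smulₛₗ, LinearMap.smul_apply, LinearMap.sum_apply, h.tensorPower_tprod,
    smul_eq_mul]
  have key : ∀ ρ : Perm (Fin n), ∑ π : Perm (Fin n),
      ∏ i, h.inner σ (toCx σ (u (π i))) (toCx σ (v (ρ i))) =
      ∑ π : Perm (Fin n), ∏ i, h.inner σ (toCx σ (u (π i))) (toCx σ (v i)) := fun ρ =>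
    Fintype.sum_equiv (Equiv.mulRight ρ⁻¹) _ _ fun π =>
      Fintype.prod_equiv ρ _ _ fun i => by simp
  have hn : (n.factorial : ℂ) ≠ 0 := by exact_mod_cast n.factorial_ne_zero
  simp only [key, Finset.sum_const, Finset.card_univ, Fintype.card_perm, Fintype.card_fin,
    nsmul_eq_mul, map_inv₀, map_natCast]
  rw [inv_mul_cancel_left₀ hn]

end SymmetricPower

section Criterion

variable {F : Type*} [AddCommGroup F] [Module (𝓞 K) F]

/-- The norm `‖φ‖_σ` of `φ ∈ Hom(E, F)`: the operator norm of `φ_σ : E_σ → F_σ`. When `F` has rank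
one, `Hom(E, F) = E^∨ ⊗ F` and this is the norm of its hermitian metric. -/
noncomputable def homNorm (hE : Metric K E) (hF : Metric K F) (σ : K →+* ℂ) (φ : E →ₗ[𝓞 K] F) : ℝ :=
  sInf {c : ℝ | 0 ≤ c ∧ ∀ u : Cx σ E, hF.norm σ (mapCx σ φ u) ≤ c * hE.norm σ u}

/-- The image of `f^{⊗ n}` in `(Symⁿ E)_σ`. -/
noncomputable def symPow (σ : K →+* ℂ) (n : ℕ) (f : Cx σ E) : Cx σ (Sym[𝓞 K]^n E) :=
  multiCx σ n (SymmetricPower.tprod (𝓞 K)) fun _ => f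

/-- The complex subspace `W ⊗_K ℂ` of `E_σ`, for a `K`-subspace `W` of `E_K`. -/
noncomputable def subspaceCx (σ : K →+* ℂ) (W : Submodule K (K ⊗[𝓞 K] E)) :
    Submodule ℂ (Cx σ E) :=
  Submodule.span ℂ (genericToCx σ E '' W)

/-- The smallest `K`-subspace `V` of `E_K` such that `f ∈ V ⊗_K ℂ`. -/
noncomputable def minSubspace (σ : K →+* ℂ) (f : Cx σ E) : Submodule K (K ⊗[𝓞 K] E) :=
  sInf {W | f ∈ subspaceCx σ W}

/-- `f ∈ E_σ` is algebraically independent over `K`: for every `n ≥ 1` the smallest `K`-subspace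
of `(Symⁿ E)_K` containing the image of `f^{⊗ n}` is `(Symⁿ E)_K` itself. -/
def AlgIndependent (σ : K →+* ℂ) (f : Cx σ E) : Prop :=
  ∀ n : ℕ, 0 < n → minSubspace σ (symPow σ n f) = ⊤

/-- The hypotheses of the linear independence criterion for `f ∈ E_σ` with constants
`c₁, c₂, c₃, b₁, b₂`. Here `m` is the rank of `E` and `E^∨(x) = Hom(E, H^{⊗ x})`; the
inequalities between logarithms of norms are written after exponentiation, so that a vanishing
norm satisfies them. -/
def SmallForms {H : Type*} [AddCommGroup H] [Module (𝓞 K) H] [Module.Finite (𝓞 K) H]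
    (hE : Metric K E) (hH : Metric K H) (σ : K →+* ℂ) (f : Cx σ E) (c₁ c₂ c₃ b₁ b₂ : ℝ) : Prop :=
  let m := finrank (𝓞 K) E
  ∀ᶠ x : ℕ in atTop, ∃ P : Fin m → (E →ₗ[𝓞 K] ⨂[𝓞 K]^x H),
    LinearIndependent (𝓞 K) P ∧
    (∀ i, ∀ τ : K →+* ℂ, homNorm hE (hH.tensorPower x) τ (P i) ≤
      Real.exp (c₁ * x * Real.log x + b₁ * x)) ∧
    (∀ i, (hH.tensorPower x).norm σ (mapCx σ (P i) f) ≤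
      Real.exp (c₁ * x * Real.log x - c₂ * m * x * Real.log x + c₃ * x * Real.log x + b₂ * x))

end Criterion
end Hermitian

/-! Write `D = [K : ℚ]`. The heart of the matter is a bound on how many independent `K`-linear forms
can vanish at `f` (`SmallForms.rank_bound`). Suppose that `s` of them do, in rank `m`. By exchange,
`m - s` of the small forms `P_i` complete them to a basis of all forms. After clearing a fixed
denominator, the matrix of values of these forms at an integral basis of `E_K` has a nonzero
determinant in `𝓞 K`, so the product of its absolute values over the `D` embeddings is at least 1.
At each embedding the `s` fixed rows cost `O(1)` and each of the others costs `exp(c₁ x log x +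
O(x))`; at `σ`, Cramer's rule gains `exp((-c₂ m + c₃) x log x + O(x))`. Comparing coefficients of `x
log x` gives `0 ≤ D (m - s) c₁ - c₂ m + c₃`. The twist by `H`, the metrics and `b₁`, `b₂` only enter
through `O(x)`.

Linear forms on `Symⁿ E` are homogeneous polynomials of degree `n` (`symPoly_bijective`), evaluated
at the coordinates of `f`. A nonzero relation `G` of degree `k` thus produces vanishing forms on
`Sym^{j+k} E`: its multiples, as many as there are monomials of degree `j`. For fixed `k` the
proportion `s / m` tends to 1 as `j` grows (`formDim_div_tendsto`). Dividing the bound by `m` and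
letting `j → ∞` yields `0 ≤ -c₂`, a contradiction. This needs `m → ∞`, hence at least two variables;
one variable is elementary because `f ≠ 0`.

Finally, a proper subspace of `(Symⁿ E)_K` lies in the kernel of a nonzero form, so the absence of
relations gives the statement about minimal subspaces. -/

namespace Hermitian

/-! ### Linear forms on complexifications. -/

section Forms

variable {K : Type} [Field K] (σ : K →+* ℂ)
variable {E : Type*} [AddCommGroup E] [Module (𝓞 K) E]

theorem span_range_toCx : Submodule.span ℂ (Set.range (toCx σ : E → Cx σ E)) = ⊤ := by
  refine eq_top_iff.mpr fun u _ => ?_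
  induction u using Cx.induction with
  | h0 => exact zero_mem _
  | hs z e => exact Submodule.smul_mem _ _ (Submodule.subset_span ⟨e, rfl⟩)
  | ha u v hu hv => exact add_mem (hu trivial) (hv trivial)

/-- The complexification `E_σ → ℂ` of a linear form `E → K`. -/
noncomputable def formCx (Ψ : E →ₗ[𝓞 K] K) : Cx σ E →ₗ[ℂ] ℂ :=
  liftCx σ
    { toFun := fun u => σ (Ψ u)
      map_add' := fun u v => by simp
      map_smul' := fun r u => by
        rw [map_smul, Algebra.smul_def, map_mul]; rfl }

theorem formCx_toCx (Ψ : E →ₗ[𝓞 K] K) (u : E) : formCx σ Ψ (toCx σ u) = σ (Ψ u) :=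
  liftCx_toCx σ _ u

theorem formCx_genericToCx (Ψ : E →ₗ[𝓞 K] K) (u : K ⊗[𝓞 K] E) :
    formCx σ Ψ (genericToCx σ E u) = σ (Ψ.liftBaseChange K u) := by
  induction u using TensorProduct.induction_on with
  | zero => simp
  | tmul k e => rw [genericToCx_tmul, map_smul, formCx_toCx]; simp
  | add u v hu hv => rw [map_add, map_add, hu, hv, map_add, map_add]

theorem toCx_eq_genericToCx (u : E) : toCx σ u = genericToCx σ E (1 ⊗ₜ[𝓞 K] u) := by
  rw [genericToCx_tmul, map_one, one_smul]

/-- Expansion in `E_σ` along a `K`-basis of `E_K` that consists of elements of `E`. -/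
theorem exists_expansion {J : Type*} [Fintype J] (b : Basis J K (K ⊗[𝓞 K] E)) {e : J → E}
    (hb : ∀ j, b j = 1 ⊗ₜ[𝓞 K] e j) (u : Cx σ E) :
    ∃ w : J → ℂ, u = ∑ j, w j • toCx σ (e j) := by
  induction u using Cx.induction with
  | h0 => exact ⟨0, by simp⟩
  | hs z u =>
    refine ⟨fun j => z * σ (b.repr (1 ⊗ₜ u) j), ?_⟩
    rw [toCx_eq_genericToCx]
    conv_lhs => rw [← b.sum_repr (1 ⊗ₜ u)]
    simp only [map_sum, Finset.smul_sum, mul_smul, LinearMap.map_smulₛₗ, hb, toCx_eq_genericToCx]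
  | ha u v hu hv =>
    obtain ⟨w, rfl⟩ := hu
    obtain ⟨w', rfl⟩ := hv
    exact ⟨w + w', by simp [add_smul, Finset.sum_add_distrib]⟩

theorem tensorForm_multiCx {n : ℕ} (φ : Fin n → (Cx σ E →ₗ[ℂ] ℂ)) (u : Fin n → Cx σ E) :
    tensorForm σ φ (multiCx σ n (PiTensorProduct.tprod (𝓞 K)) u) = ∏ i, φ i (u i) := by
  have : (tensorForm σ φ).compMultilinearMap (multiCx σ n (PiTensorProduct.tprod (𝓞 K))) =
      (MultilinearMap.mkPiAlgebra ℂ (Fin n) ℂ).compLinearMap φ := by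
    refine MultilinearMap.ext_of_span_eq_top (g := fun _ => (toCx σ : E → Cx σ E))
      (fun _ => span_range_toCx σ) fun j => ?_
    simp only [LinearMap.compMultilinearMap_apply, MultilinearMap.compLinearMap_apply,
      MultilinearMap.mkPiAlgebra_apply, multiCx_toCx, tensorForm_tprod]
  exact DFunLike.congr_fun this u

end Forms

/-! ### Norm estimates for homomorphisms and tensor powers. -/

section Norms

variable {K : Type} [Field K] {σ : K →+* ℂ}
variable {E : Type*} [AddCommGroup E] [Module (𝓞 K) E] [Module.Finite (𝓞 K) E]
variable {F : Type*} [AddCommGroup F] [Module (𝓞 K) F]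

theorem Metric.norm_nonneg {M : Type*} [AddCommGroup M] [Module (𝓞 K) M] (h : Metric K M)
    (u : Cx σ M) : 0 ≤ h.norm σ u := Real.sqrt_nonneg _

theorem Metric.exists_bound (hE : Metric K E) (hF : Metric K F) (φ : Cx σ E →ₗ[ℂ] Cx σ F) :
    ∃ c : ℝ, 0 ≤ c ∧ ∀ u, hF.norm σ (φ u) ≤ c * hE.norm σ u := by
  let : NormedAddCommGroup (Cx σ E) := (hE.core σ).toNormedAddCommGroup
  let : InnerProductSpace ℂ (Cx σ E) := InnerProductSpace.ofCore (hE.core σ).toCore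
  let : NormedAddCommGroup (Cx σ F) := (hF.core σ).toNormedAddCommGroup
  let : InnerProductSpace ℂ (Cx σ F) := InnerProductSpace.ofCore (hF.core σ).toCore
  let g := LinearMap.toContinuousLinearMap φ
  exact ⟨‖g‖, g.opNorm_nonneg, fun u => g.le_opNorm u⟩

/-- The infimum in `homNorm` is attained. Finite dimension makes the set of admissible constants
nonempty, which rules out the default value `sInf ∅ = 0`. -/
theorem norm_mapCx_le (hE : Metric K E) (hF : Metric K F) (φ : E →ₗ[𝓞 K] F) (u : Cx σ E) :
    hF.norm σ (mapCx σ φ u) ≤ homNorm hE hF σ φ * hE.norm σ u := by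
  obtain ⟨c₀, hc₀⟩ := hE.exists_bound hF (mapCx σ φ)
  rcases (hE.norm_nonneg u).eq_or_lt with h0 | hpos
  · have := hc₀.2 u
    rw [← h0] at this ⊢
    simpa using this
  · rw [← div_le_iff₀ hpos]
    exact le_csInf ⟨c₀, hc₀⟩ fun c hc => (div_le_iff₀ hpos).mpr (hc.2 u)

theorem Metric.norm_tensorPower (h : Metric K E) (n : ℕ) (t : Cx σ (⨂[𝓞 K]^n E)) :
    (h.tensorPower n).norm σ t = √(∑ I, ‖h.tensorCoord σ n I t‖ ^ 2) := by
  unfold Metric.norm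
  congr 1
  change (coordForm (h.tensorCoord σ n) t t).re = _
  simp only [coordForm, LinearMap.mk₂'ₛₗ_apply, Complex.re_sum]
  refine Finset.sum_congr rfl fun I _ => ?_
  rw [← Complex.normSq_eq_conj_mul_self, Complex.ofReal_re, Complex.normSq_eq_norm_sq]

/-- `C` is the `ℓ²` norm of `φ` in an orthonormal basis. The `ℓ²` norm of the coefficients of `φ^{⊗
n}` is exactly `C ^ n`, and Cauchy–Schwarz concludes. -/
theorem Metric.exists_tensorForm_bound (h : Metric K E) (φ : Cx σ E →ₗ[ℂ] ℂ) :
    ∃ C : ℝ, ∀ (n : ℕ) (t : Cx σ (⨂[𝓞 K]^n E)),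
      ‖tensorForm σ (fun _ : Fin n => φ) t‖ ≤ C ^ n * (h.tensorPower n).norm σ t := by
  set e := (h.exists_orthonormal σ).choose with he
  refine ⟨√(∑ k, ‖φ (e k)‖ ^ 2), fun n t => ?_⟩
  have h1 : tensorForm σ (fun _ : Fin n => φ) t =
      ∑ I, h.tensorCoord σ n I t * ∏ j, φ (e (I j)) := by
    conv_lhs => rw [h.tensorCoord_expand σ n t]
    simp only [map_sum, map_smul, smul_eq_mul, tensorForm_multiCx, he]
  have h2 : (√(∑ k, ‖φ (e k)‖ ^ 2)) ^ n = √(∑ I : Fin n → _, (∏ j, ‖φ (e (I j))‖) ^ 2) := by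
    rw [eq_comm, Real.sqrt_eq_iff_eq_sq (by positivity) (by positivity), ← pow_mul, mul_comm n,
      pow_mul, Real.sq_sqrt (by positivity)]
    simp_rw [← Finset.prod_pow]
    rw [← Fintype.piFinset_univ, ← Finset.prod_univ_sum (fun _ => Finset.univ)
      (fun (_ : Fin n) k => ‖φ (e k)‖ ^ 2)]
    simp
  rw [h1, h2, h.norm_tensorPower, mul_comm]
  calc _ ≤ ∑ I, ‖h.tensorCoord σ n I t‖ * ∏ j, ‖φ (e (I j))‖ := by
        refine (norm_sum_le _ _).trans (Finset.sum_le_sum fun I _ => ?_)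
        rw [norm_mul, norm_prod]
    _ ≤ _ := Real.sum_mul_le_sqrt_mul_sqrt _ _ _

end Norms

end Hermitian

namespace Hermitian

/-! ### Replacing values in `H^{⊗ x}` by scalars. -/

section LineBundle

variable {K : Type} [Field K]
variable {H : Type*} [AddCommGroup H] [Module (𝓞 K) H] [Module.Invertible (𝓞 K) H]

/-- The `K`-valued linear form given by an `𝓞 K`-valued one. -/
noncomputable def formK {E : Type*} [AddCommGroup E] [Module (𝓞 K) E] (Q : E →ₗ[𝓞 K] 𝓞 K) :
    E →ₗ[𝓞 K] K :=
  Algebra.linearMap (𝓞 K) K ∘ₗ Q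

theorem formK_apply {E : Type*} [AddCommGroup E] [Module (𝓞 K) E] (Q : E →ₗ[𝓞 K] 𝓞 K) (u : E) :
    formK Q u = algebraMap (𝓞 K) K (Q u) := rfl

variable (K H) in
-- The contraction `H^∨ ⊗ H → 𝓞 K` is onto, so some `ψ h` is nonzero. Every endomorphism of an
-- invertible module is a scalar, in particular `u ↦ ψ u • h`. Thus `ψ` trivializes `H` up to the
-- factor `a`.
theorem exists_quasi_trivialization :
    ∃ (a : 𝓞 K) (ψ : H →ₗ[𝓞 K] 𝓞 K) (h : H), a ≠ 0 ∧ ∀ u, ψ u • h = a • u := by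
  obtain ⟨ψ, h, hne⟩ : ∃ (ψ : H →ₗ[𝓞 K] 𝓞 K) (h : H), ψ h ≠ 0 := by
    by_contra! hall
    obtain ⟨t, ht⟩ := (Module.Invertible.linearEquiv (𝓞 K) H).surjective 1
    have h0 : ∀ t : Dual (𝓞 K) H ⊗[𝓞 K] H, contractLeft (𝓞 K) H t = 0 := fun t => by
      induction t using TensorProduct.induction_on with
      | zero => simp
      | tmul ψ h => simpa using hall ψ h
      | add a b ha hb => rw [map_add, ha, hb, add_zero]
    exact one_ne_zero (ht.symm.trans (h0 t))
  obtain ⟨a, ha⟩ := (Module.Invertible.toModuleEnd_bijective (𝓞 K) H).2 (ψ.smulRight h)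
  have hu : ∀ u, ψ u • h = a • u := fun u => (LinearMap.congr_fun ha u).symm
  refine ⟨a, ψ, h, fun h0 => hne ?_, hu⟩
  have h1 := congrArg ψ (hu h)
  rw [h0, zero_smul, map_zero, map_smul, smul_eq_mul] at h1
  exact mul_self_eq_zero.mp h1

/-- Tensor powers of one quasi-trivialization serve for all `x`. The loss `C ^ x`, uniform in `τ`,
is harmless next to `exp(x log x)`. -/
theorem exists_power_trivialization [NumberField K] (hH : Metric K H) :
    ∃ C : ℝ, 1 ≤ C ∧ ∀ x : ℕ, ∃ (a : 𝓞 K) (ψ : (⨂[𝓞 K]^x H) →ₗ[𝓞 K] 𝓞 K)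
      (g : ⨂[𝓞 K]^x H), a ≠ 0 ∧ (∀ t, ψ t • g = a • t) ∧
      ∀ (τ : K →+* ℂ) (t : Cx τ (⨂[𝓞 K]^x H)),
        ‖formCx τ (formK ψ) t‖ ≤ C ^ x * (hH.tensorPower x).norm τ t := by
  obtain ⟨a, ψ, h, ha, hψ⟩ := exists_quasi_trivialization K H
  choose C hC using fun τ : K →+* ℂ => hH.exists_tensorForm_bound (formCx τ (formK ψ))
  obtain ⟨B, hB⟩ := (Set.finite_range fun τ => |C τ|).bddAbove
  refine ⟨max 1 B, le_max_left _ _, fun x => ?_⟩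
  let ψx : (⨂[𝓞 K]^x H) →ₗ[𝓞 K] 𝓞 K := PiTensorProduct.lift
    ((MultilinearMap.mkPiAlgebra (𝓞 K) (Fin x) (𝓞 K)).compLinearMap fun _ => ψ)
  have hψx : ∀ u : Fin x → H, ψx (PiTensorProduct.tprod (𝓞 K) u) = ∏ i, ψ (u i) := fun u => by
    simp [ψx]
  refine ⟨a ^ x, ψx, PiTensorProduct.tprod (𝓞 K) fun _ => h, pow_ne_zero _ ha, fun t => ?_,
    fun τ t => ?_⟩
  · induction t using PiTensorProduct.induction_on with
    | smul_tprod r u =>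
      rw [map_smul, smul_assoc, smul_comm _ r, hψx]
      congr 1
      rw [← MultilinearMap.map_smul_univ]
      simp_rw [hψ]
      rw [MultilinearMap.map_smul_univ]
      simp
    | add u v hu hv => rw [map_add, add_smul, hu, hv, smul_add]
  · have h1 : formCx τ (formK ψx) = tensorForm τ fun _ : Fin x => formCx τ (formK ψ) := by
      refine Cx.ext τ fun t => ?_
      rw [formCx_toCx]
      induction t using PiTensorProduct.induction_on with
      | smul_tprod r u =>
        rw [(formK ψx).map_smul, Algebra.smul_def, map_mul, (toCx τ).map_smulₛₗ,
          LinearMap.map_smul, tensorForm_tprod, formK_apply, hψx]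
        simp only [formCx_toCx, formK_apply, map_prod]
        rfl
      | add u v hu hv => simp only [map_add, hu, hv]
    rw [h1]
    refine (hC τ x t).trans (mul_le_mul_of_nonneg_right ?_ (Metric.norm_nonneg _ _))
    refine (le_abs_self _).trans ?_
    rw [abs_pow]
    exact pow_le_pow_left₀ (abs_nonneg _) ((hB ⟨τ, rfl⟩).trans (le_max_right _ _)) _

/-- Linearly independent homomorphisms to `H^{⊗ x}` give linearly independent forms, whose size is
controlled up to a factor that is exponential in `x`. -/
theorem exists_scalar_forms [NumberField K] (hH : Metric K H)
    {E : Type*} [AddCommGroup E] [Module (𝓞 K) E] :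
    ∃ C : ℝ, 1 ≤ C ∧ ∀ (x m : ℕ) (P : Fin m → (E →ₗ[𝓞 K] ⨂[𝓞 K]^x H)),
      LinearIndependent (𝓞 K) P → ∃ Q : Fin m → (E →ₗ[𝓞 K] 𝓞 K),
        LinearIndependent K (fun i => formK (Q i)) ∧
        ∀ i (τ : K →+* ℂ) (u : Cx τ E), ‖formCx τ (formK (Q i)) u‖ ≤
          C ^ x * (hH.tensorPower x).norm τ (mapCx τ (P i) u) := by
  obtain ⟨C, hC, h⟩ := exists_power_trivialization hH
  refine ⟨C, hC, fun x m P hP => ?_⟩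
  obtain ⟨a, ψ, g, ha, hψ, hbd⟩ := h x
  refine ⟨fun i => ψ ∘ₗ P i, ?_, fun i τ u => ?_⟩
  · rw [← LinearIndependent.iff_fractionRing (R := 𝓞 K), Fintype.linearIndependent_iff]
    intro c hc i
    rw [Fintype.linearIndependent_iff] at hP
    -- A value killed by `ψ` is killed by `a`, so a relation between the `ψ ∘ P i` becomes one
    -- between the `P i` after multiplication by `a`.
    have h0 : ∑ i, (a * c i) • P i = 0 := by
      ext u
      have h1 : ψ (∑ i, c i • P i u) = 0 := by
        have := LinearMap.congr_fun hc u
        simp only [LinearMap.sum_apply, LinearMap.smul_apply, formK_apply, LinearMap.comp_apply,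
          LinearMap.zero_apply, Algebra.smul_def, ← map_mul, ← map_sum] at this
        have := (FaithfulSMul.algebraMap_injective (𝓞 K) K) (this.trans (map_zero _).symm)
        simpa using this
      have h2 := hψ (∑ i, c i • P i u)
      rw [h1, zero_smul] at h2
      simp [mul_smul, ← Finset.smul_sum, ← h2]
    exact (mul_eq_zero.mp (hP _ h0 i)).resolve_left ha
  · have h1 : formCx τ (formK (ψ ∘ₗ P i)) = formCx τ (formK ψ) ∘ₗ mapCx τ (P i) :=
      Cx.ext τ fun u => by
        simp only [LinearMap.comp_apply, mapCx_toCx, formCx_toCx, formK_apply]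
    rw [h1]
    exact hbd τ _

end LineBundle

/-! ### The determinant estimate. -/

section Determinant

/-- Each term of the Leibniz expansion contains exactly one entry of column `j₀`, hence gains `ε`
once. -/
theorem norm_det_le_of_col {J : Type*} [Fintype J] [DecidableEq J] (A : Matrix J J ℂ) (β : J → ℝ)
    (ε : ℝ) (j₀ : J) (h : ∀ i j, j ≠ j₀ → ‖A i j‖ ≤ β i) (h₀ : ∀ i, ‖A i j₀‖ ≤ β i * ε) :
    ‖A.det‖ ≤ (Fintype.card J).factorial * (∏ i, β i) * ε := by
  have key : ∀ π : Equiv.Perm J, ‖Equiv.Perm.sign π • ∏ i, A (π i) i‖ ≤ (∏ i, β i) * ε := by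
    intro π
    have h1 : ‖Equiv.Perm.sign π • ∏ i, A (π i) i‖ = ∏ i, ‖A (π i) i‖ := by
      rw [← norm_prod]
      rcases Int.units_eq_one_or (Equiv.Perm.sign π) with hs | hs <;> simp [hs]
    rw [h1]
    calc ∏ i, ‖A (π i) i‖ ≤ ∏ i, (β (π i) * if i = j₀ then ε else 1) := by
          refine Finset.prod_le_prod (fun i _ => norm_nonneg _) fun i _ => ?_
          split_ifs with hi
          · rw [hi]; exact h₀ _
          · rw [mul_one]; exact h _ _ hi
      _ = _ := by
          rw [Finset.prod_mul_distrib, Equiv.prod_comp π β, Finset.prod_ite_eq' Finset.univ j₀]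
          simp
  rw [Matrix.det_apply]
  refine (norm_sum_le _ _).trans ((Finset.sum_le_sum fun π _ => key π).trans_eq ?_)
  rw [Finset.sum_const, Finset.card_univ, Fintype.card_perm, nsmul_eq_mul, mul_assoc]

variable {K : Type} [Field K] [NumberField K]

/-- The product is the absolute value of the norm of `Δ`, a nonzero integer. -/
theorem one_le_prod_embeddings {Δ : 𝓞 K} (h : Δ ≠ 0) : 1 ≤ ∏ τ : K →+* ℂ, ‖τ (Δ : K)‖ := by
  have h1 : ∏ τ : K →+* ℂ, ‖τ (Δ : K)‖ = ‖((Algebra.norm ℤ Δ : ℤ) : ℝ)‖ := by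
    have := congr_arg (‖·‖) (Algebra.norm_eq_prod_embeddings ℚ ℂ (Δ : K))
    rw [norm_prod, ← Fintype.prod_equiv (RingHom.equivRatAlgHom K ℂ) (fun f => ‖f (Δ : K)‖)
      (fun φ => ‖φ (Δ : K)‖) fun _ => by simp [RingHom.equivRatAlgHom_apply]] at this
    rw [← this, ← Algebra.coe_norm_int]
    simp
  rw [h1, Real.norm_eq_abs, ← Int.cast_abs]
  exact_mod_cast Int.one_le_abs (Algebra.norm_ne_zero_iff.mpr h)

/-- The determinant estimate: a regular integral matrix whose rows are of size `β i` at all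
embeddings cannot have all its rows arbitrarily small at a given vector. -/
theorem norm_le_of_det_ne_zero (σ : K →+* ℂ) {J : Type*} [Fintype J] [DecidableEq J]
    (A : Matrix J J (𝓞 K)) (hA : A.det ≠ 0) (w : J → ℂ) (β : J → ℝ) (ε : ℝ) (hε : 0 ≤ ε)
    (h : ∀ (τ : K →+* ℂ) i j, ‖τ (A i j : K)‖ ≤ β i)
    (hw : ∀ i, ‖∑ j, w j * σ (A i j : K)‖ ≤ β i * ε) (j₀ : J) :
    ‖w j₀‖ ≤ ((Fintype.card J).factorial * ∏ i, β i) ^ finrank ℚ K * ε := by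
  classical
  set B : ℝ := (Fintype.card J).factorial * ∏ i, β i with hB
  have hdet : ∀ τ : K →+* ℂ, τ (A.det : K) = (A.map (emb τ)).det := fun τ =>
    RingHom.map_det (emb τ) A
  have h1 : ∀ τ : K →+* ℂ, ‖τ (A.det : K)‖ ≤ B := fun τ => by
    rw [hdet]
    simpa using norm_det_le_of_col (A.map (emb τ)) β 1 j₀ (fun i j _ => h τ i j)
      (fun i => by rw [mul_one]; exact h τ i j₀)
  -- Cramer's rule: replacing column `j₀` by the combination of the columns with weights `w`
  -- multiplies the determinant by `w j₀`.
  have h2 : ‖w j₀‖ * ‖σ (A.det : K)‖ ≤ B * ε := by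
    rw [hdet, ← norm_mul, ← smul_eq_mul, ← Matrix.det_updateCol_sum (A.map (emb σ)) j₀ w]
    refine norm_det_le_of_col _ β ε j₀ (fun i j hj => ?_) fun i => ?_
    · rw [Matrix.updateCol_ne hj]; exact h σ i j
    · rw [Matrix.updateCol_self]; exact hw i
  have hcard : Fintype.card (K →+* ℂ) = finrank ℚ K := NumberField.Embeddings.card K ℂ
  calc ‖w j₀‖ ≤ ‖w j₀‖ * ∏ τ : K →+* ℂ, ‖τ (A.det : K)‖ :=
        le_mul_of_one_le_right (norm_nonneg _) (one_le_prod_embeddings hA)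
    _ = (‖w j₀‖ * ‖σ (A.det : K)‖) * ∏ τ ∈ Finset.univ.erase σ, ‖τ (A.det : K)‖ := by
        rw [mul_assoc, Finset.mul_prod_erase _ (fun τ : K →+* ℂ => ‖τ (A.det : K)‖)
          (Finset.mem_univ σ)]
    _ ≤ (B * ε) * ∏ τ ∈ Finset.univ.erase σ, B :=
        mul_le_mul h2 (Finset.prod_le_prod (fun _ _ => norm_nonneg _) fun τ _ => h1 τ)
          (Finset.prod_nonneg fun _ _ => norm_nonneg _)
          (mul_nonneg ((norm_nonneg _).trans (h1 σ)) hε)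
    _ = (B * ∏ τ ∈ Finset.univ.erase σ, B) * ε := by ring
    _ = _ := by
        rw [Finset.mul_prod_erase _ (fun _ => B) (Finset.mem_univ σ), Finset.prod_const,
          Finset.card_univ, hcard]

end Determinant

end Hermitian

/-! ### Exchange of linear forms. -/

section LinearAlgebra

/-- Steinitz exchange: the images of the `Q i` span the quotient by the span of `L`, so `m - s` of
them form a basis of it. -/
theorem exists_linearIndependent_sumElim {k V : Type*} [Field k] [AddCommGroup V] [Module k V]
    [FiniteDimensional k V] {s m : ℕ} (hm : finrank k V = m) {L : Fin s → V}
    (hL : LinearIndependent k L) {Q : Fin m → V} (hQ : LinearIndependent k Q) :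
    ∃ t : Fin (m - s) → Fin m, LinearIndependent k (Sum.elim L (Q ∘ t)) := by
  set U := Submodule.span k (Set.range L) with hU
  have hdimU : finrank k U = s := by rw [finrank_span_eq_card hL, Fintype.card_fin]
  have hspan : Submodule.span k (Set.range (U.mkQ ∘ Q)) = ⊤ := by
    rw [Set.range_comp, Submodule.span_image,
      hQ.span_eq_top_of_card_eq_finrank' (by simp [hm]), Submodule.map_top, Submodule.range_mkQ]
  have hdim : finrank k (Submodule.span k (Set.range (U.mkQ ∘ Q))) = m - s := by
    rw [hspan, finrank_top, ← hm, ← hdimU, ← U.finrank_quotient_add_finrank, Nat.add_sub_cancel]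
  obtain ⟨g, hg, -, hind⟩ :=
    Submodule.exists_fun_fin_finrank_span_eq k (Set.range (U.mkQ ∘ Q))
  choose t ht using hg
  refine ⟨t ∘ Fin.cast hdim.symm, ?_⟩
  have h1 : LinearIndependent k (U.mkQ ∘ (Q ∘ t ∘ Fin.cast hdim.symm)) := by
    have : U.mkQ ∘ (Q ∘ t ∘ Fin.cast hdim.symm) = g ∘ Fin.cast hdim.symm :=
      funext fun i => ht _
    rw [this]
    exact hind.comp _ (Fin.cast_injective _)
  exact LinearIndependent.sumElim_of_quotient (M' := U)
    (f := fun i => ⟨L i, Submodule.subset_span ⟨i, rfl⟩⟩)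
    (LinearIndependent.of_comp U.subtype hL) _ h1

end LinearAlgebra

namespace Hermitian

/-! ### `K`-valued forms and integral bases of `E_K`. -/

section Forms

variable {K : Type} [Field K]
variable {E : Type*} [AddCommGroup E] [Module (𝓞 K) E]

instance [Module.Finite (𝓞 K) E] : FiniteDimensional K (E →ₗ[𝓞 K] K) :=
  Module.Finite.equiv (LinearMap.liftBaseChangeEquiv (R := 𝓞 K) (M := E) (N := K) K).symm

variable (K E) in
theorem finrank_baseChange_fractionField : finrank K (K ⊗[𝓞 K] E) = finrank (𝓞 K) E :=
  (TensorProduct.isBaseChange (𝓞 K) E K).finrank_eq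

variable (K E) in
theorem finrank_forms : finrank K (E →ₗ[𝓞 K] K) = finrank (𝓞 K) E := by
  rw [(LinearMap.liftBaseChangeEquiv (R := 𝓞 K) (M := E) (N := K) K).finrank_eq,
    ← finrank_baseChange_fractionField K E]
  exact Subspace.dual_finrank_eq

theorem span_range_one_tmul :
    Submodule.span K (Set.range fun u : E => (1 : K) ⊗ₜ[𝓞 K] u) = ⊤ := by
  refine eq_top_iff.mpr fun u _ => ?_
  induction u using TensorProduct.induction_on with
  | zero => exact zero_mem _
  | tmul k e =>
    have : k ⊗ₜ[𝓞 K] e = k • ((1 : K) ⊗ₜ[𝓞 K] e) := by rw [TensorProduct.smul_tmul']; simp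
    rw [this]
    exact Submodule.smul_mem _ _ (Submodule.subset_span ⟨e, rfl⟩)
  | add u v hu hv => exact add_mem (hu trivial) (hv trivial)

variable (K E) in
-- The elements `1 ⊗ u` span `E_K`, so a basis can be chosen among them, whether or not `E` is free.
theorem exists_integral_basis [NumberField K] [Module.Finite (𝓞 K) E] {J : Type*}
    [Fintype J] (hJ : Fintype.card J = finrank (𝓞 K) E) :
    ∃ (b : Basis J K (K ⊗[𝓞 K] E)) (e : J → E), ∀ j, b j = 1 ⊗ₜ[𝓞 K] e j := by
  obtain ⟨g, hg, hspan, hind⟩ :=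
    Submodule.exists_fun_fin_finrank_span_eq K (Set.range fun u : E => (1 : K) ⊗ₜ[𝓞 K] u)
  choose e he using hg
  let b := Basis.mk hind (hspan.trans span_range_one_tmul).ge
  let φ : Fin (finrank K (Submodule.span K (Set.range fun u : E => (1 : K) ⊗ₜ[𝓞 K] u))) ≃ J :=
    Fintype.equivOfCardEq (by
      rw [Fintype.card_fin, span_range_one_tmul, finrank_top, finrank_baseChange_fractionField, hJ])
  refine ⟨b.reindex φ, e ∘ φ.symm, fun j => ?_⟩
  rw [Basis.reindex_apply, Basis.mk_apply]
  exact (he _).symm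

theorem det_forms_ne_zero {J : Type*} [Fintype J] [DecidableEq J] (b : Basis J K (K ⊗[𝓞 K] E))
    {e : J → E} (hb : ∀ j, b j = 1 ⊗ₜ[𝓞 K] e j) {R : J → (E →ₗ[𝓞 K] K)}
    (hR : LinearIndependent K R) : (Matrix.of fun i j => R i (e j)).det ≠ 0 := by
  intro h0
  obtain ⟨v, hv, h1⟩ := Matrix.exists_vecMul_eq_zero_iff.mpr h0
  refine hv (funext (Fintype.linearIndependent_iff.mp hR v ?_))
  refine (LinearMap.liftBaseChangeEquiv K).injective ?_
  refine b.ext fun j => ?_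
  have := congrFun h1 j
  simp only [Matrix.vecMul, dotProduct, Matrix.of_apply, Pi.zero_apply] at this
  rw [hb, LinearMap.liftBaseChange_tmul, map_zero]
  simpa using this

end Forms

/-- Divide by `x log x` and let `x` tend to infinity. -/
theorem nonneg_of_eventually_mul_log {A B C : ℝ}
    (h : ∀ᶠ x : ℕ in atTop, 0 ≤ A * (x * Real.log x) + B * x + C) : 0 ≤ A := by
  have hlog : Tendsto (fun x : ℕ => Real.log x) atTop atTop :=
    Real.tendsto_log_atTop.comp tendsto_natCast_atTop_atTop
  have h1 : Tendsto (fun x : ℕ => A + (B + C * (x : ℝ)⁻¹) * (Real.log x)⁻¹) atTop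
      (nhds (A + (B + C * 0) * 0)) :=
    tendsto_const_nhds.add ((tendsto_const_nhds.add (tendsto_const_nhds.mul
      (tendsto_inv_atTop_zero.comp tendsto_natCast_atTop_atTop))).mul
      (tendsto_inv_atTop_zero.comp hlog))
  rw [mul_zero, add_zero] at h1
  refine ge_of_tendsto h1 ?_
  filter_upwards [h, eventually_ge_atTop 1, hlog.eventually_gt_atTop 0] with x hx h1 hl
  have hx0 : (0 : ℝ) < x := by exact_mod_cast h1
  have : A + (B + C * (x : ℝ)⁻¹) * (Real.log x)⁻¹ =
      (A * (x * Real.log x) + B * x + C) / (x * Real.log x) := by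
    field_simp
    ring
  rw [this]
  positivity

/-! ### The bound on the number of vanishing forms. -/

section Criterion

variable {K : Type} [Field K] [NumberField K]
variable {E : Type*} [AddCommGroup E] [Module (𝓞 K) E] [Module.Finite (𝓞 K) E]
variable {H : Type*} [AddCommGroup H] [Module (𝓞 K) H] [Module.Invertible (𝓞 K) H]

theorem SmallForms.rank_bound {hE : Metric K E} {hH : Metric K H} {σ : K →+* ℂ} {f : Cx σ E}
    {c₁ c₂ c₃ b₁ b₂ : ℝ} (h : SmallForms hE hH σ f c₁ c₂ c₃ b₁ b₂) (hf : f ≠ 0) {s : ℕ}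
    {L : Fin s → (E →ₗ[𝓞 K] K)} (hL : LinearIndependent K L) (hLf : ∀ i, formCx σ (L i) f = 0) :
    s ≤ finrank (𝓞 K) E ∧
      0 ≤ finrank ℚ K * (finrank (𝓞 K) E - s : ℝ) * c₁ - c₂ * finrank (𝓞 K) E + c₃ := by
  classical
  set m := finrank (𝓞 K) E with hm
  set D := finrank ℚ K
  have hs : s ≤ m := by
    simpa [finrank_forms] using hL.fintype_card_le_finrank
  refine ⟨hs, ?_⟩
  obtain ⟨b, e, hb⟩ := exists_integral_basis K E (J := Fin s ⊕ Fin (m - s))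
    (by rw [Fintype.card_sum, Fintype.card_fin, Fintype.card_fin, Nat.add_sub_cancel' hs])
  obtain ⟨w, hw⟩ := exists_expansion σ b hb f
  obtain ⟨j₀, hj₀⟩ : ∃ j₀, w j₀ ≠ 0 := by
    by_contra! hall
    exact hf (by rw [hw]; simp [hall])
  have hform : ∀ Ψ : E →ₗ[𝓞 K] K, formCx σ Ψ f = ∑ j, w j * σ (Ψ (e j)) := fun Ψ => by
    conv_lhs => rw [hw]
    simp [formCx_toCx]
  -- A common denominator of the values `L i (e j)`. Like `w`, `j₀`, `B₁`, `B₂` and `C`, it does not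
  -- depend on `x`.
  obtain ⟨⟨a, ha⟩, hint⟩ := IsLocalization.exist_integer_multiples_of_finite (nonZeroDivisors (𝓞 K))
    (fun p : Fin s × (Fin s ⊕ Fin (m - s)) => L p.1 (e p.2))
  choose A₀ hA₀ using fun i j => hint (i, j)
  have ha0 : algebraMap (𝓞 K) K a ≠ 0 := by
    simpa using nonZeroDivisors.ne_zero ha
  obtain ⟨B₁, hB₁⟩ := (Set.finite_range fun p : (K →+* ℂ) × Fin s × (Fin s ⊕ Fin (m - s)) =>
    ‖p.1 (A₀ p.2.1 p.2.2 : K)‖).bddAbove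
  obtain ⟨B₂, hB₂⟩ := (Set.finite_range fun p : (K →+* ℂ) × (Fin s ⊕ Fin (m - s)) =>
    hE.norm p.1 (toCx p.1 (e p.2))).bddAbove
  obtain ⟨C, hC, hforms⟩ := exists_scalar_forms hH (E := E)
  set N : ℝ := ((Fintype.card (Fin s ⊕ Fin (m - s))).factorial : ℝ) with hN
  have hNpos : 0 < N := by rw [hN]; exact_mod_cast Nat.factorial_pos _
  set B₁' := max 1 B₁
  set B₂' := max 1 B₂
  have hB₁' : 1 ≤ B₁' := le_max_left _ _
  have hB₂' : 1 ≤ B₂' := le_max_left _ _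
  have key : ∀ᶠ x : ℕ in atTop, ‖w j₀‖ ≤ (N * (B₁' ^ s *
      (C ^ x * Real.exp (c₁ * x * Real.log x + b₁ * x) * B₂') ^ (m - s))) ^ D *
      Real.exp ((-c₂ * m + c₃) * (x * Real.log x) + (b₂ - b₁) * x) := by
    filter_upwards [h] with x hx
    obtain ⟨P, hP, hP1, hP2⟩ := hx
    obtain ⟨Q, hQ, hQP⟩ := hforms x m P hP
    obtain ⟨t, ht⟩ := exists_linearIndependent_sumElim (finrank_forms K E) hL hQ
    set β := C ^ x * Real.exp (c₁ * x * Real.log x + b₁ * x) * B₂' with hβ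
    -- The quotient of the two bounds in the hypothesis: smallness at `f` relative to the size of
    -- the form.
    set ε := Real.exp ((-c₂ * m + c₃) * (x * Real.log x) + (b₂ - b₁) * x) with hε
    let A : Matrix (Fin s ⊕ Fin (m - s)) (Fin s ⊕ Fin (m - s)) (𝓞 K) :=
      Matrix.of fun i j => Sum.elim (fun i => A₀ i j) (fun i => Q (t i) (e j)) i
    have hdet : A.det ≠ 0 := by
      have h1 := det_forms_ne_zero b hb ht
      -- Over `K`, `A` is the matrix of the completed system of forms with its first `s` rows
      -- multiplied by `a`.
      have h2 : (A.map (algebraMap (𝓞 K) K)) = Matrix.of fun i j =>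
          (Sum.elim (fun _ => algebraMap (𝓞 K) K a) (fun _ => 1) i) *
          (Matrix.of (fun i j => (Sum.elim L ((fun i => formK (Q i)) ∘ t)) i (e j))) i j := by
        ext i j
        rcases i with i | i
        · simp only [A, Matrix.map_apply, Matrix.of_apply, Sum.elim_inl]
          rw [hA₀, Algebra.smul_def]
        · simp [A, formK_apply]
      intro h0
      have h3 := congrArg (algebraMap (𝓞 K) K) h0
      rw [RingHom.map_det, RingHom.mapMatrix_apply, h2, Matrix.det_mul_column, map_zero] at h3
      rcases mul_eq_zero.mp h3 with h4 | h4
      · rw [Finset.prod_eq_zero_iff] at h4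
        obtain ⟨i, -, hi⟩ := h4
        rcases i with i | i
        · exact ha0 hi
        · exact one_ne_zero hi
      · exact h1 h4
    have hQe : ∀ (τ : K →+* ℂ) i j, ‖τ (Q i (e j) : K)‖ ≤ β := fun τ i j => by
      have h1 := hQP i τ (toCx τ (e j))
      rw [formCx_toCx] at h1
      refine h1.trans ?_
      rw [hβ, mul_assoc]
      refine mul_le_mul_of_nonneg_left ?_ (by positivity)
      refine (norm_mapCx_le hE _ _ _).trans (mul_le_mul (hP1 i τ) ?_ (hE.norm_nonneg _)
        (Real.exp_pos _).le)
      exact (hB₂ ⟨(τ, j), rfl⟩).trans (le_max_right _ _)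
    have hQf : ∀ i, ‖∑ j, w j * σ (Q i (e j) : K)‖ ≤ β * ε := fun i => by
      have h1 := hQP i σ f
      rw [hform] at h1
      refine h1.trans ?_
      have h2 : β * ε = C ^ x * (B₂' * Real.exp (c₁ * x * Real.log x - c₂ * m * x * Real.log x +
          c₃ * x * Real.log x + b₂ * x)) := by
        rw [hβ, hε, mul_assoc (C ^ x), mul_comm (Real.exp _) B₂', mul_assoc (C ^ x), mul_assoc B₂',
          ← Real.exp_add]
        congr 3
        ring
      rw [h2]
      refine mul_le_mul_of_nonneg_left ((hP2 i).trans ?_) (by positivity)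
      -- The factor `B₂'` is needed only for the values at `e j`; being at least 1, it may stay
      -- here, so that one `β` serves both estimates.
      exact le_mul_of_one_le_left (Real.exp_pos _).le hB₂'
    -- The rows from `L` have size bounded independently of `x`, and they vanish at `f`, so they
    -- satisfy the condition for every `ε`.
    have h1 := norm_le_of_det_ne_zero σ A hdet w (Sum.elim (fun _ => B₁') fun _ => β) ε
      (Real.exp_pos _).le (fun τ i j => ?_) (fun i => ?_) j₀
    · rw [Fintype.prod_sum_type] at h1
      simpa only [Sum.elim_inl, Sum.elim_inr, Finset.prod_const, Finset.card_univ,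
        Fintype.card_fin] using h1
    · rcases i with i | i
      · exact (hB₁ ⟨(τ, i, j), rfl⟩).trans (le_max_right _ _)
      · exact hQe τ (t i) j
    · rcases i with i | i
      · have h2 : ∑ j, w j * σ (A (Sum.inl i) j : K) = 0 := by
          have : ∀ j, σ (A (Sum.inl i) j : K) = σ (algebraMap (𝓞 K) K a) * σ (L i (e j)) :=
            fun j => by
              rw [← map_mul, ← Algebra.smul_def]
              exact congrArg σ (hA₀ i j)
          simp_rw [this, mul_left_comm (w _), ← Finset.mul_sum, ← hform, hLf, mul_zero]
        rw [h2, norm_zero]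
        simp only [Sum.elim_inl]
        positivity
      · exact hQf (t i)
  have hgoal : (D : ℝ) * (m - s : ℝ) * c₁ - c₂ * m + c₃ =
      D * ((m - s : ℕ) : ℝ) * c₁ - c₂ * m + c₃ := by rw [Nat.cast_sub hs]
  rw [hgoal]
  -- `B` and `C` are the coefficients of `x` and of 1 in the logarithm of `key`; the term `log ‖w
  -- j₀‖` is a constant because `w j₀ ≠ 0`.
  refine nonneg_of_eventually_mul_log
    (B := D * ((m - s : ℕ) : ℝ) * (Real.log C + b₁) + (b₂ - b₁))
    (C := D * (Real.log N + s * Real.log B₁' + ((m - s : ℕ) : ℝ) * Real.log B₂') -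
      Real.log ‖w j₀‖) ?_
  filter_upwards [key] with x hx
  have hC0 : 0 < C := by linarith
  have h1 := Real.log_le_log (norm_pos_iff.mpr hj₀) hx
  rw [Real.log_mul (by positivity) (by positivity), Real.log_exp, Real.log_pow,
    Real.log_mul (by positivity) (by positivity), Real.log_mul (by positivity) (by positivity),
    Real.log_pow, Real.log_pow, Real.log_mul (by positivity) (by positivity),
    Real.log_mul (by positivity) (by positivity), Real.log_exp, Real.log_pow] at h1
  linarith

end Criterion

end Hermitian

/-! ### Homogeneous polynomials. -/

namespace MvPolynomial

variable {ι k : Type*} [Field k]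

theorem homogeneousSubmodule_eq_span_range_prod_X (n : ℕ) :
    homogeneousSubmodule ι k n =
      Submodule.span k (Set.range fun I : Fin n → ι => ∏ j, (X (I j) : MvPolynomial ι k)) := by
  rw [← homogeneousSubmodule_one_pow, homogeneousSubmodule_one_eq_span_X, Submodule.span_pow]
  congr 1
  ext p
  rw [Set.mem_pow]
  constructor
  · rintro ⟨f, rfl⟩
    choose I hI using fun i => (f i).2
    exact ⟨I, by simp [hI, List.prod_ofFn]⟩
  · rintro ⟨I, rfl⟩
    exact ⟨fun i => ⟨X (I i), I i, rfl⟩, by simp [List.prod_ofFn]⟩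

/-- Stars and bars. The truncated subtraction is correct for `d = 0` too: it gives 1 for `n = 0` and
0 otherwise. -/
theorem finrank_homogeneousSubmodule (d n : ℕ) :
    finrank k (homogeneousSubmodule (Fin d) k n) = (d + n - 1).choose n := by
  classical
  have h1 : homogeneousSubmodule (Fin d) k n = Submodule.span k
      (Set.range fun α : {α // α ∈ Finset.finsuppAntidiag (Finset.univ : Finset (Fin d)) n} =>
        monomial α.1 (1 : k)) := by
    ext p
    constructor
    · intro hp
      rw [p.as_sum]
      refine sum_mem fun α hα => ?_
      have : α ∈ Finset.finsuppAntidiag (Finset.univ : Finset (Fin d)) n := by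
        rw [Finset.mem_finsuppAntidiag]
        refine ⟨?_, Finset.subset_univ _⟩
        rw [← Finsupp.degree_eq_sum]
        by_contra hne
        exact (mem_support_iff.mp hα) (IsHomogeneous.coeff_eq_zero hp hne)
      have h2 : monomial α (coeff α p) = coeff α p • monomial α (1 : k) := by
        rw [smul_monomial, smul_eq_mul, mul_one]
      rw [h2]
      exact Submodule.smul_mem _ _ (Submodule.subset_span ⟨⟨α, this⟩, rfl⟩)
    · intro hp
      refine (Submodule.span_le (p := homogeneousSubmodule (Fin d) k n)).mpr ?_ hp
      rintro _ ⟨⟨α, hα⟩, rfl⟩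
      refine isHomogeneous_monomial _ ?_
      rw [Finsupp.degree_eq_sum]
      exact (Finset.mem_finsuppAntidiag.mp hα).1
  rw [h1, finrank_span_eq_card, Fintype.card_coe, Finset.card_finsuppAntidiag_nat_eq_choose,
    Finset.card_univ, Fintype.card_fin]
  have := (basisMonomials (Fin d) k).linearIndependent.comp
    (fun α : {α // α ∈ Finset.finsuppAntidiag (Finset.univ : Finset (Fin d)) n} => α.1)
    Subtype.val_injective
  simpa [Function.comp_def] using this

theorem IsHomogeneous.eval₂_mul_left {S : Type*} [CommSemiring S] {σ : k →+* S} [Fintype ι]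
    {G : MvPolynomial ι k} {n : ℕ} (hG : G.IsHomogeneous n) (c : S) (z : ι → S) :
    G.eval₂ σ (fun i => c * z i) = c ^ n * G.eval₂ σ z := by
  rw [eval₂_eq', eval₂_eq', Finset.mul_sum]
  refine Finset.sum_congr rfl fun α hα => ?_
  have hdeg : ∑ i, α i = n := by
    rw [← Finsupp.degree_eq_sum]
    by_contra hne
    exact (mem_support_iff.mp hα) (hG.coeff_eq_zero hne)
  simp_rw [mul_pow]
  rw [Finset.prod_mul_distrib, Finset.prod_pow_eq_pow_sum, hdeg]
  ring

theorem prod_X_eq_monomial {n : ℕ} (I : Fin n → ι) :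
    ∏ j, (X (I j) : MvPolynomial ι k) = monomial (∑ j, Finsupp.single (I j) 1) 1 := by
  rw [monomial_sum_one]
  rfl

end MvPolynomial

/-- Fibres of `I` and `J` over the same point have equal cardinality; bijections between them glue
to a permutation. -/
theorem exists_perm_comp_eq {α : Type*} [DecidableEq α] {n : ℕ} {I J : Fin n → α}
    (h : ∑ j, Finsupp.single (I j) 1 = ∑ j, Finsupp.single (J j) (1 : ℕ)) :
    ∃ π : Equiv.Perm (Fin n), ∀ i, J (π i) = I i := by
  have hcard : ∀ a, Nonempty ({i // I i = a} ≃ {i // J i = a}) := fun a => by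
    refine ⟨Fintype.equivOfCardEq ?_⟩
    have := DFunLike.congr_fun h a
    simpa [Finsupp.finsetSum_apply, Finsupp.single_apply, Fintype.card_subtype] using this
  let φ := fun a => (hcard a).some
  refine ⟨((Equiv.sigmaFiberEquiv I).symm.trans (Equiv.sigmaCongrRight φ)).trans
    (Equiv.sigmaFiberEquiv J), fun i => ?_⟩
  exact (φ (I i) ⟨i, rfl⟩).2

namespace Hermitian

/-! ### Linear forms on `Symⁿ E` as homogeneous polynomials. -/

section SymmetricForms

open MvPolynomial

variable {K : Type} [Field K]
variable {E : Type*} [AddCommGroup E] [Module (𝓞 K) E]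

/-- The linear map `Symⁿ E → A`, `u₁ ⋯ uₙ ↦ ∏ ℓ uᵢ`. -/
noncomputable def symLift {A : Type*} [CommRing A] [Algebra (𝓞 K) A] (ℓ : E →ₗ[𝓞 K] A) (n : ℕ) :
    Sym[𝓞 K]^n E →ₗ[𝓞 K] A :=
  let g : ⨂[𝓞 K]^n E →ₗ[𝓞 K] A := PiTensorProduct.lift
    ((MultilinearMap.mkPiAlgebra (𝓞 K) (Fin n) A).compLinearMap fun _ => ℓ)
  let g' : Sym[𝓞 K]^n E →+ A :=
    AddCon.lift _ g.toAddMonoidHom (AddCon.addConGen_le.mpr (by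
      rintro _ _ ⟨e, u⟩
      change g (PiTensorProduct.tprod (𝓞 K) u) = g (PiTensorProduct.tprod (𝓞 K) fun i => u (e i))
      simp only [g, PiTensorProduct.lift.tprod, MultilinearMap.compLinearMap_apply,
        MultilinearMap.mkPiAlgebra_apply]
      exact (Equiv.prod_comp e fun i => ℓ (u i)).symm))
  { g' with
    map_smul' := fun r s => by
      induction s using AddCon.induction_on with
      | _ t => exact map_smul g r t }

theorem symLift_tprod {A : Type*} [CommRing A] [Algebra (𝓞 K) A] (ℓ : E →ₗ[𝓞 K] A) {n : ℕ}
    (u : Fin n → E) : symLift ℓ n (SymmetricPower.tprod (𝓞 K) u) = ∏ i, ℓ (u i) := by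
  change PiTensorProduct.lift _ (PiTensorProduct.tprod (𝓞 K) u) = _
  simp

instance (n : ℕ) [Module.Finite (𝓞 K) E] : Module.Finite (𝓞 K) (Sym[𝓞 K]^n E) :=
  Module.Finite.of_surjective (SymmetricPower.mk (𝓞 K) (Fin n) E)
    (LinearMap.range_eq_top.mp (SymmetricPower.range_mk (𝓞 K) (Fin n) E))

/-- The polynomial `∑ Ψ (e_{I 1} ⋯ e_{I n}) X_{I 1} ⋯ X_{I n}` of a linear form on `Symⁿ E`. -/
noncomputable def symPoly {d : ℕ} (e : Fin d → E) (n : ℕ) :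
    (Sym[𝓞 K]^n E →ₗ[𝓞 K] K) →ₗ[K] MvPolynomial (Fin d) K where
  toFun Ψ := ∑ I : Fin n → Fin d,
    C (Ψ (SymmetricPower.tprod (𝓞 K) fun j => e (I j))) * ∏ j, X (I j)
  map_add' Ψ Φ := by simp [add_mul, Finset.sum_add_distrib]
  map_smul' c Ψ := by simp [Finset.smul_sum, MvPolynomial.smul_eq_C_mul, mul_assoc]

theorem symPoly_isHomogeneous {d : ℕ} (e : Fin d → E) (n : ℕ) (Ψ : Sym[𝓞 K]^n E →ₗ[𝓞 K] K) :
    (symPoly e n Ψ).IsHomogeneous n := by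
  refine IsHomogeneous.sum _ _ _ fun I _ => IsHomogeneous.C_mul ?_ _
  simpa using IsHomogeneous.prod Finset.univ (fun j => (X (I j) : MvPolynomial (Fin d) K))
    (fun _ => 1) fun j _ => isHomogeneous_X K (I j)

theorem eval₂_symPoly (σ : K →+* ℂ) {d : ℕ} (e : Fin d → E) (z : Fin d → ℂ) (n : ℕ)
    (Ψ : Sym[𝓞 K]^n E →ₗ[𝓞 K] K) :
    (symPoly e n Ψ).eval₂ σ z = formCx σ Ψ (symPow σ n (∑ i, z i • toCx σ (e i))) := by
  unfold symPow
  rw [MultilinearMap.map_sum, map_sum, symPoly]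
  simp only [LinearMap.coe_mk, AddHom.coe_mk, eval₂_sum, eval₂_mul, eval₂_C, eval₂_prod, eval₂_X]
  refine Finset.sum_congr rfl fun I _ => ?_
  rw [MultilinearMap.map_smul_univ, map_smul, multiCx_toCx, formCx_toCx, smul_eq_mul, mul_comm]

/-- The `e i` need not generate `E`, but they span `E_σ`. So the vanishing is proved for the
complexified multilinear map and brought back by injectivity of `σ`. -/
theorem symForm_eq_zero {σ : K →+* ℂ} {d : ℕ} {e : Fin d → E}
    (he : Submodule.span ℂ (Set.range fun i => toCx σ (e i)) = ⊤) {n : ℕ}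
    {Ψ : Sym[𝓞 K]^n E →ₗ[𝓞 K] K}
    (h : ∀ I : Fin n → Fin d, Ψ (SymmetricPower.tprod (𝓞 K) fun j => e (I j)) = 0) : Ψ = 0 := by
  have h1 : (formCx σ Ψ).compMultilinearMap (multiCx σ n (SymmetricPower.tprod (𝓞 K))) = 0 := by
    refine MultilinearMap.ext_of_span_eq_top (g := fun _ i => toCx σ (e i)) (fun _ => he)
      fun I => ?_
    rw [LinearMap.compMultilinearMap_apply, multiCx_toCx, formCx_toCx, h, map_zero]
    rfl
  refine LinearMap.ext_on (SymmetricPower.span_tprod_eq_top (𝓞 K) (Fin n) E) ?_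
  rintro _ ⟨u, rfl⟩
  have h2 := DFunLike.congr_fun h1 (fun i => toCx σ (u i))
  rw [LinearMap.compMultilinearMap_apply, multiCx_toCx, formCx_toCx] at h2
  exact (map_eq_zero σ).mp h2

/-- The coefficient of a monomial is the value of `Ψ` at the corresponding product times the number
of index tuples giving that monomial. This number is invertible in characteristic zero. -/
theorem symPoly_injective {σ : K →+* ℂ} {d : ℕ} {e : Fin d → E}
    (he : Submodule.span ℂ (Set.range fun i => toCx σ (e i)) = ⊤) (n : ℕ) :
    Function.Injective (symPoly (K := K) e n) := by
  classical
  rw [injective_iff_map_eq_zero]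
  intro Ψ hΨ
  refine symForm_eq_zero he fun I => ?_
  have hchar : CharZero K := σ.charZero
  have h1 := congrArg (coeff (∑ j, Finsupp.single (I j) 1)) hΨ
  simp only [symPoly, LinearMap.coe_mk, AddHom.coe_mk, coeff_sum, coeff_C_mul, prod_X_eq_monomial,
    coeff_monomial, mul_ite, mul_one, mul_zero, coeff_zero] at h1
  rw [← Finset.sum_filter] at h1
  have h2 : ∀ J ∈ Finset.univ.filter fun J : Fin n → Fin d =>
      ∑ j, Finsupp.single (J j) 1 = ∑ j, Finsupp.single (I j) 1,
      Ψ (SymmetricPower.tprod (𝓞 K) fun j => e (J j)) =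
        Ψ (SymmetricPower.tprod (𝓞 K) fun j => e (I j)) := fun J hJ => by
    obtain ⟨π, hπ⟩ := exists_perm_comp_eq (Finset.mem_filter.mp hJ).2
    rw [← SymmetricPower.tprod_equiv π fun j => e (I j)]
    simp_rw [hπ]
  rw [Finset.sum_congr rfl h2, Finset.sum_const, smul_eq_zero] at h1
  refine h1.resolve_left (Finset.card_ne_zero.mpr ⟨I, ?_⟩)
  simp

/-- Sending `e i` to `X i` induces a map from `(Symⁿ E)_K` whose image contains all monomials of
degree `n`. With the injectivity of `symPoly`, this determines the rank. -/
theorem finrank_homogeneousSubmodule_le [Module.Finite (𝓞 K) E] {d : ℕ}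
    (b : Basis (Fin d) K (K ⊗[𝓞 K] E)) {e : Fin d → E} (hb : ∀ j, b j = 1 ⊗ₜ[𝓞 K] e j) (n : ℕ) :
    finrank K (homogeneousSubmodule (Fin d) K n) ≤ finrank (𝓞 K) (Sym[𝓞 K]^n E) := by
  let ℓ : E →ₗ[𝓞 K] MvPolynomial (Fin d) K :=
    ((b.constr K fun i => (X i : MvPolynomial (Fin d) K)).restrictScalars (𝓞 K)) ∘ₗ
      TensorProduct.mk (𝓞 K) K E 1
  have hℓ : ∀ i, ℓ (e i) = X i := fun i => by
    change b.constr K _ (1 ⊗ₜ[𝓞 K] e i) = _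
    rw [← hb, Basis.constr_basis]
  have h1 : homogeneousSubmodule (Fin d) K n ≤
      LinearMap.range ((symLift ℓ n).liftBaseChange K) := by
    rw [homogeneousSubmodule_eq_span_range_prod_X, Submodule.span_le]
    rintro _ ⟨I, rfl⟩
    refine ⟨1 ⊗ₜ SymmetricPower.tprod (𝓞 K) fun j => e (I j), ?_⟩
    rw [LinearMap.liftBaseChange_one_tmul]
    exact (symLift_tprod ℓ _).trans (Finset.prod_congr rfl fun j _ => hℓ (I j))
  rw [← finrank_baseChange_fractionField K (Sym[𝓞 K]^n E)]
  exact (Submodule.finrank_mono h1).trans (LinearMap.finrank_range_le _)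

/-- Linear forms on `Symⁿ E` are the same as homogeneous polynomials of degree `n`. -/
theorem symPoly_bijective [Module.Finite (𝓞 K) E] (σ : K →+* ℂ) {d : ℕ}
    (b : Basis (Fin d) K (K ⊗[𝓞 K] E)) {e : Fin d → E} (hb : ∀ j, b j = 1 ⊗ₜ[𝓞 K] e j) (n : ℕ) :
    finrank (𝓞 K) (Sym[𝓞 K]^n E) = finrank K (homogeneousSubmodule (Fin d) K n) ∧
      ∃ Γ : (Sym[𝓞 K]^n E →ₗ[𝓞 K] K) ≃ₗ[K] homogeneousSubmodule (Fin d) K n,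
        ∀ (Ψ : Sym[𝓞 K]^n E →ₗ[𝓞 K] K) (z : Fin d → ℂ),
          (Γ Ψ : MvPolynomial (Fin d) K).eval₂ σ z =
            formCx σ Ψ (symPow σ n (∑ i, z i • toCx σ (e i))) := by
  have he : Submodule.span ℂ (Set.range fun i => toCx σ (e i)) = ⊤ := by
    refine eq_top_iff.mpr fun u _ => ?_
    obtain ⟨w, rfl⟩ := exists_expansion σ b hb u
    exact sum_mem fun i _ => Submodule.smul_mem _ _ (Submodule.subset_span ⟨i, rfl⟩)
  have : FiniteDimensional K (homogeneousSubmodule (Fin d) K n) :=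
    Module.Finite.iff_fg.mpr (homogeneousSubmodule_fg (Fin d) K n)
  let Γ : (Sym[𝓞 K]^n E →ₗ[𝓞 K] K) →ₗ[K] homogeneousSubmodule (Fin d) K n :=
    (symPoly e n).codRestrict _ (symPoly_isHomogeneous e n)
  have hinj : Function.Injective Γ := fun Ψ Φ h =>
    symPoly_injective he n (congrArg Subtype.val h)
  have hrank : finrank (𝓞 K) (Sym[𝓞 K]^n E) = finrank K (homogeneousSubmodule (Fin d) K n) := by
    refine le_antisymm ?_ (finrank_homogeneousSubmodule_le b hb n)
    rw [← finrank_forms]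
    exact LinearMap.finrank_le_finrank_of_injective hinj
  refine ⟨hrank, LinearEquiv.ofInjectiveOfFinrankEq Γ hinj ?_, fun Ψ z => ?_⟩
  · rw [finrank_forms, hrank]
  · exact eval₂_symPoly σ e z n Ψ

end SymmetricForms

end Hermitian

/-! ### Growth of the number of monomials. -/

section Asymptotics

/-- The dimension of the space of forms of degree `n` in `d` variables. -/
abbrev formDim (d n : ℕ) : ℝ := ((d + n - 1).choose n : ℕ)

theorem formDim_pos {d : ℕ} (hd : 2 ≤ d) (n : ℕ) : 0 < formDim d n := by
  exact_mod_cast Nat.choose_pos (by omega)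

theorem formDim_tendsto_atTop {d : ℕ} (hd : 2 ≤ d) : Tendsto (formDim d) atTop atTop := by
  refine tendsto_atTop_mono (fun n => ?_) tendsto_natCast_atTop_atTop
  have h1 : (n + 1).choose n ≤ (d + n - 1).choose n := Nat.choose_le_choose n (by omega)
  rw [Nat.choose_succ_self_right] at h1
  exact_mod_cast (Nat.le_succ n).trans h1

theorem formDim_div_succ {d : ℕ} (hd : 2 ≤ d) (n : ℕ) :
    formDim d n / formDim d (n + 1) = 1 - (d - 1 : ℝ) / (n + d : ℝ) := by
  obtain ⟨c, rfl⟩ := Nat.exists_eq_add_of_le hd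
  have h1 : ((1 + c + n + 1) * (1 + c + n).choose n : ℕ) =
      (1 + c + n + 1).choose (n + 1) * (n + 1) := Nat.add_one_mul_choose_eq _ _
  have h2 : ((1 + c + n + 1 : ℝ)) * formDim (2 + c) n = formDim (2 + c) (n + 1) * (n + 1) := by
    unfold formDim
    rw [show 2 + c + n - 1 = 1 + c + n by omega, show 2 + c + (n + 1) - 1 = 1 + c + n + 1 by omega]
    exact_mod_cast h1
  have h3 : (n + (2 + c) : ℝ) ≠ 0 := by positivity
  rw [div_eq_iff (formDim_pos hd _).ne']
  push_cast
  field_simp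
  linarith

/-- The quotient of consecutive dimensions is `1 - (d - 1) / (n + d)`; a shift by `k` is a product
of `k` such factors. -/
theorem formDim_div_tendsto {d : ℕ} (hd : 2 ≤ d) (k : ℕ) :
    Tendsto (fun j => formDim d j / formDim d (j + k)) atTop (nhds 1) := by
  induction k with
  | zero =>
    simp_rw [add_zero, div_self (formDim_pos hd _).ne']
    exact tendsto_const_nhds
  | succ k ih =>
    have h1 : Tendsto (fun n : ℕ => 1 - (d - 1 : ℝ) / (n + d : ℝ)) atTop (nhds (1 - 0)) :=
      tendsto_const_nhds.sub (tendsto_const_nhds.div_atTop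
        (tendsto_atTop_add_const_right _ _ tendsto_natCast_atTop_atTop))
    have h2 := ih.mul (h1.comp (tendsto_add_atTop_nat k))
    rw [sub_zero, one_mul] at h2
    refine h2.congr fun j => ?_
    rw [Function.comp_apply, ← formDim_div_succ hd, ← add_assoc,
      div_mul_div_cancel₀ (formDim_pos hd _).ne']

end Asymptotics

namespace Hermitian

/-! ### Relations, minimal subspaces and the case of one variable. -/

section Relations

open MvPolynomial

variable {K : Type} [Field K] {E : Type*} [AddCommGroup E] [Module (𝓞 K) E]

/-- Every `K`-basis of `E_K` becomes integral after multiplication by some element of `𝓞 K`. -/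
theorem exists_integral_multiple [NumberField K] {d : ℕ} (b : Basis (Fin d) K (K ⊗[𝓞 K] E)) :
    ∃ (a : K) (b' : Basis (Fin d) K (K ⊗[𝓞 K] E)) (e : Fin d → E), a ≠ 0 ∧
      (∀ j, b' j = a • b j) ∧ ∀ j, b' j = 1 ⊗ₜ[𝓞 K] e j := by
  obtain ⟨⟨a, ha⟩, hint⟩ := IsLocalizedModule.exist_integer_multiples_of_finite
    (nonZeroDivisors (𝓞 K)) (TensorProduct.mk (𝓞 K) K E 1) b
  choose e he using hint
  have ha0 : algebraMap (𝓞 K) K a ≠ 0 := by simpa using nonZeroDivisors.ne_zero ha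
  refine ⟨algebraMap (𝓞 K) K a, b.unitsSMul fun _ => Units.mk0 _ ha0, e, ha0, fun j => ?_,
    fun j => ?_⟩
  · rw [Basis.unitsSMul_apply]; rfl
  · rw [Basis.unitsSMul_apply]
    refine Eq.trans ?_ (he j).symm
    exact algebraMap_smul K a (b j)

/-- If `W` is proper, a nonzero functional on `(Symⁿ E)_K` kills it. When the complexification of
`W` contains the power of `f`, the corresponding polynomial is a nontrivial relation. -/
theorem algIndependent_of_no_relation [Module.Finite (𝓞 K) E] {σ : K →+* ℂ} {d : ℕ}
    (b : Basis (Fin d) K (K ⊗[𝓞 K] E)) {e : Fin d → E} (hb : ∀ j, b j = 1 ⊗ₜ[𝓞 K] e j) {z : Fin d → ℂ}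
    (h : ∀ (n : ℕ) (G : MvPolynomial (Fin d) K), G.IsHomogeneous n → G.eval₂ σ z = 0 → G = 0) :
    AlgIndependent σ (∑ i, z i • toCx σ (e i)) := by
  intro n _
  rw [minSubspace, sInf_eq_top]
  intro W hW
  by_contra hne
  obtain ⟨u, hu⟩ : ∃ u, u ∉ W := by
    by_contra! hall
    exact hne (eq_top_iff.mpr fun u _ => hall u)
  obtain ⟨φ, hφu, hφW⟩ := Submodule.exists_le_ker_of_notMem hu
  obtain ⟨-, Γ, hΓ⟩ := symPoly_bijective σ b hb n
  let Ψ := (LinearMap.liftBaseChangeEquiv (R := 𝓞 K) K).symm φ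
  have hΨ : Ψ.liftBaseChange K = φ := LinearEquiv.apply_symm_apply _ φ
  have h0 : formCx σ Ψ (symPow σ n (∑ i, z i • toCx σ (e i))) = 0 := by
    have hle : subspaceCx σ W ≤ LinearMap.ker (formCx σ Ψ) := by
      refine Submodule.span_le.mpr ?_
      rintro _ ⟨v, hv, rfl⟩
      change formCx σ Ψ _ = 0
      rw [formCx_genericToCx, hΨ, hφW hv, map_zero]
    exact hle hW
  have h1 : Γ Ψ = 0 := Subtype.ext (h n _ (Γ Ψ).2 ((hΓ Ψ z).trans h0))
  have h2 : Ψ = 0 := by simpa using h1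
  refine hφu ?_
  rw [← hΨ, h2]
  exact LinearMap.congr_fun (map_zero (LinearMap.liftBaseChangeEquiv (R := 𝓞 K) K)) u

/-- In one variable `G` is a scalar times `X ^ k`, and the coordinate of a nonzero point is nonzero.
-/
theorem fin_one_eq_zero_of_eval₂_eq_zero (σ : K →+* ℂ) {z : Fin 1 → ℂ} (hz : z ≠ 0) {k : ℕ}
    {G : MvPolynomial (Fin 1) K} (hG : G.IsHomogeneous k) (hGz : G.eval₂ σ z = 0) : G = 0 := by
  have hz0 : z 0 ≠ 0 := fun h => hz (funext fun i => by rw [Subsingleton.elim i 0, h]; rfl)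
  have hc : ∀ α : Fin 1 →₀ ℕ, α 0 ≠ k → coeff α G = 0 := fun α hα =>
    hG.coeff_eq_zero (by rwa [Finsupp.degree_eq_sum, Fin.sum_univ_one])
  have hsub : G.support ⊆ {Finsupp.single 0 k} := fun α hα => by
    rw [Finset.mem_singleton]
    refine Finsupp.ext fun i => ?_
    rw [Subsingleton.elim i 0, Finsupp.single_eq_same]
    by_contra hne
    exact mem_support_iff.mp hα (hc α hne)
  rw [eval₂_eq', Finset.sum_subset hsub fun α _ hα => by
    rw [notMem_support_iff.mp hα, map_zero, zero_mul], Finset.sum_singleton] at hGz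
  simp only [Fin.prod_univ_one, Finsupp.single_eq_same] at hGz
  have h0 := (map_eq_zero σ).mp ((mul_eq_zero.mp hGz).resolve_right (pow_ne_zero _ hz0))
  ext α
  by_cases hα : α ∈ G.support
  · rw [Finset.mem_singleton.mp (hsub hα), h0, coeff_zero]
  · rw [notMem_support_iff.mp hα, coeff_zero]

end Relations

/-! ### The contradiction from a relation. -/

section Main

open MvPolynomial

variable {K : Type} [Field K] [NumberField K]
variable {E : Type*} [AddCommGroup E] [Module (𝓞 K) E] [Module.Finite (𝓞 K) E]
variable {H : Type*} [AddCommGroup H] [Module (𝓞 K) H] [Module.Invertible (𝓞 K) H]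

/-- A relation of degree `k` bounds the ranks of the symmetric powers in terms of their growth. -/
theorem SmallForms.formDim_bound {hE : Metric K E} {hH : Metric K H} {σ : K →+* ℂ} {d : ℕ}
    (b : Basis (Fin d) K (K ⊗[𝓞 K] E)) {e : Fin d → E} (hb : ∀ j, b j = 1 ⊗ₜ[𝓞 K] e j)
    {z : Fin d → ℂ} (hz : z ≠ 0) {k : ℕ} {G : MvPolynomial (Fin d) K} (hG : G.IsHomogeneous k)
    (hG0 : G ≠ 0) (hGz : G.eval₂ σ z = 0) {j : ℕ} {c₁ c₂ c₃ b₁ b₂ : ℝ}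
    (h : SmallForms (hE.symPower (j + k)) hH σ (symPow σ (j + k) (∑ i, z i • toCx σ (e i)))
      c₁ c₂ c₃ b₁ b₂) :
    0 ≤ finrank ℚ K * (formDim d (j + k) - formDim d j) * c₁ - c₂ * formDim d (j + k) + c₃ := by
  obtain ⟨hrank, Γ, hΓ⟩ := symPoly_bijective σ b hb (j + k)
  have : FiniteDimensional K (homogeneousSubmodule (Fin d) K j) :=
    Module.Finite.iff_fg.mpr (homogeneousSubmodule_fg (Fin d) K j)
  have hmul : ∀ p : homogeneousSubmodule (Fin d) K j,
      G * p.1 ∈ homogeneousSubmodule (Fin d) K (j + k) := fun p => by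
    rw [mul_comm]; exact IsHomogeneous.mul p.2 hG
  -- Multiplication by `G`, injective since polynomials over a field form a domain. The multiples of
  -- `G` are the vanishing forms fed into `rank_bound`.
  let μ : homogeneousSubmodule (Fin d) K j →ₗ[K] homogeneousSubmodule (Fin d) K (j + k) :=
    ((LinearMap.mulLeft K G) ∘ₗ Submodule.subtype _).codRestrict _ hmul
  have hμ : Function.Injective μ := fun p q hpq =>
    Subtype.ext (mul_left_cancel₀ hG0 (congrArg Subtype.val hpq))
  let B := finBasis K (homogeneousSubmodule (Fin d) K j)
  have hL : LinearIndependent K fun i => Γ.symm (μ (B i)) :=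
    (B.linearIndependent.map' μ (LinearMap.ker_eq_bot.mpr hμ)).map' Γ.symm.toLinearMap Γ.symm.ker
  have hform : ∀ p : homogeneousSubmodule (Fin d) K (j + k),
      formCx σ (Γ.symm p) (symPow σ (j + k) (∑ i, z i • toCx σ (e i))) = p.1.eval₂ σ z :=
    fun p => by rw [← hΓ, LinearEquiv.apply_symm_apply]
  obtain ⟨i, hi⟩ := Function.ne_iff.mp hz
  have hne : symPow σ (j + k) (∑ i, z i • toCx σ (e i)) ≠ 0 := fun h0 => by
    -- The form attached to `X i ^ (j + k)` takes the value `z i ^ (j + k) ≠ 0` at the power of `f`.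
    have h1 := hform ⟨X i ^ (j + k), isHomogeneous_X_pow i (j + k)⟩
    rw [h0, map_zero, eval₂_pow, eval₂_X] at h1
    exact pow_ne_zero _ hi h1.symm
  have h1 := (h.rank_bound hne hL fun i => by
    rw [hform]
    change (G * (B i).1).eval₂ σ z = 0
    rw [eval₂_mul, hGz, zero_mul]).2
  rwa [hrank, finrank_homogeneousSubmodule, finrank_homogeneousSubmodule] at h1

theorem no_relation_of_smallForms {hE : Metric K E} {hH : Metric K H} {σ : K →+* ℂ} {d : ℕ}
    (b : Basis (Fin d) K (K ⊗[𝓞 K] E)) {e : Fin d → E} (hb : ∀ j, b j = 1 ⊗ₜ[𝓞 K] e j)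
    {z : Fin d → ℂ} (hz : z ≠ 0) {c₁ c₂ c₃ : ℝ} (hc₂ : 0 < c₂)
    (hforms : ∀ᶠ n : ℕ in atTop, ∃ b₁ b₂ : ℝ, SmallForms (hE.symPower n) hH σ
      (symPow σ n (∑ i, z i • toCx σ (e i))) c₁ c₂ c₃ b₁ b₂)
    {k : ℕ} {G : MvPolynomial (Fin d) K} (hG : G.IsHomogeneous k) (hGz : G.eval₂ σ z = 0) :
    G = 0 := by
  -- For `d = 1` all symmetric powers have rank one, so `c₃` is not absorbed by `c₂ m` and the
  -- asymptotic argument fails.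
  rcases lt_or_ge d 2 with hd | hd
  · interval_cases d
    · exact absurd (Subsingleton.elim z 0) hz
    · exact fin_one_eq_zero_of_eval₂_eq_zero σ hz hG hGz
  by_contra hG0
  set D : ℝ := (finrank ℚ K : ℝ)
  have h1 : Tendsto (fun j => D * (1 - formDim d j / formDim d (j + k)) * c₁ - c₂ +
      c₃ / formDim d (j + k)) atTop (nhds (D * (1 - 1) * c₁ - c₂ + 0)) :=
    ((((tendsto_const_nhds.sub (formDim_div_tendsto hd k)).const_mul D).mul_const c₁).sub_const
      c₂).add (tendsto_const_nhds.div_atTop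
        ((formDim_tendsto_atTop hd).comp (tendsto_add_atTop_nat k)))
  have h2 : 0 ≤ D * (1 - 1) * c₁ - c₂ + 0 := by
    refine ge_of_tendsto h1 ?_
    filter_upwards [(tendsto_add_atTop_nat k).eventually hforms] with j hj
    obtain ⟨b₁, b₂, hS⟩ := hj
    have h3 := hS.formDim_bound b hb hz hG hG0 hGz
    have hpos := formDim_pos hd (j + k)
    have h4 : D * (1 - formDim d j / formDim d (j + k)) * c₁ - c₂ + c₃ / formDim d (j + k) =
        (D * (formDim d (j + k) - formDim d j) * c₁ - c₂ * formDim d (j + k) + c₃) /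
          formDim d (j + k) := by
      field_simp
    rw [h4]
    exact div_nonneg h3 hpos.le
  linarith

end Main

end Hermitian

theorem mainTheorem7 {K : Type} [Field K] [NumberField K] (σ : K →+* ℂ)
    {E : Type*} [AddCommGroup E] [Module (𝓞 K) E] [Module.Finite (𝓞 K) E]
    [Module.Projective (𝓞 K) E] (hE : Hermitian.Metric K E)
    {H : Type*} [AddCommGroup H] [Module (𝓞 K) H] [Module.Invertible (𝓞 K) H]
    (hH : Hermitian.Metric K H)
    (f : Hermitian.Cx σ E) (hf : f ≠ 0)
    (c₁ c₂ c₃ : ℝ) (hc₂ : 0 < c₂)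
    (hforms : ∀ᶠ n : ℕ in atTop, ∃ b₁ b₂ : ℝ,
      Hermitian.SmallForms (hE.symPower n) hH σ (Hermitian.symPow σ n f) c₁ c₂ c₃ b₁ b₂) :
    Hermitian.AlgIndependent σ f ∧
    ∀ (d : ℕ) (e : Basis (Fin d) K (K ⊗[𝓞 K] E)) (z : Fin d → ℂ),
      f = ∑ i, z i • Hermitian.genericToCx σ E (e i) →
      ∀ (n : ℕ) (G : MvPolynomial (Fin d) K), G.IsHomogeneous n →
        MvPolynomial.eval₂ σ z G = 0 → G = 0 := by
  have hrel : ∀ (d : ℕ) (e : Basis (Fin d) K (K ⊗[𝓞 K] E)) (z : Fin d → ℂ),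
      f = ∑ i, z i • Hermitian.genericToCx σ E (e i) →
      ∀ (n : ℕ) (G : MvPolynomial (Fin d) K), G.IsHomogeneous n →
        MvPolynomial.eval₂ σ z G = 0 → G = 0 := by
    intro d e z hz n G hG hGz
    obtain ⟨a, b, u, ha, hb, hbu⟩ := Hermitian.exists_integral_multiple e
    have hσ : σ a ≠ 0 := (map_ne_zero σ).mpr ha
    -- Making the basis integral divides all coordinates by `σ a`; homogeneous relations survive
    -- this scaling.
    have hfz : f = ∑ i, ((σ a)⁻¹ * z i) • Hermitian.toCx σ (u i) := by
      rw [hz]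
      refine Finset.sum_congr rfl fun i _ => ?_
      rw [Hermitian.toCx_eq_genericToCx, ← hbu, hb, LinearMap.map_smulₛₗ, smul_smul,
        mul_right_comm, inv_mul_cancel₀ hσ, one_mul]
    refine Hermitian.no_relation_of_smallForms b hbu (z := fun i => (σ a)⁻¹ * z i) ?_ hc₂
      (hE := hE) (hH := hH) (c₁ := c₁) (c₃ := c₃) (by rwa [← hfz]) hG
      (by rw [hG.eval₂_mul_left, hGz, mul_zero])
    intro h0
    exact hf (hfz.trans (Finset.sum_eq_zero fun i _ => by rw [congrFun h0 i]; exact zero_smul ℂ _))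
  refine ⟨?_, hrel⟩
  obtain ⟨b, u, hbu⟩ := Hermitian.exists_integral_basis K E
    (J := Fin (finrank (𝓞 K) E)) (Fintype.card_fin _)
  obtain ⟨z, hz⟩ := Hermitian.exists_expansion σ b hbu f
  have := Hermitian.algIndependent_of_no_relation b hbu (σ := σ) (z := z)
    (hrel _ b z (by simpa only [hbu, ← Hermitian.toCx_eq_genericToCx] using hz))
  rwa [← hz] at this
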